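/- **Setting.** Let $d\ge 1$, let $(\Xi,\mathcal T,\mu)$ be a probability space and let $f:\mathbb R^d\times\Xi\to\mathbb R$ be jointly measurable. Squares, quotients and square roots of vectors are taken componentwise; $x^{\odot 2}$ is the componentwise square. Write $\mathbb E_\xi\varphi(\xi)=\int\varphi\,d\mu$, and $\nabla f(x,s)$ for the gradient in $x$. Assume: 1. *(Model.)* For every $x$, $f(x,\cdot)$ and $\nabla f(x,\cdot)^{\odot 2}$ are $\mu$-integrable; for every $s$, $f(\cdot,s)$ is differentiable; and there is a measurable $\kappa:\mathbb R^d\times\Xi\to[0,\infty)$ such that for every $x$, $\kappa(x,\cdot)$ is $\mu$-integrable and there is $\rho>0$ with $$\max\bigl(\|\nabla f(u,s)-\nabla f(w,s)\|,\ \|\nabla f(u,s)^{\odot2}-\nabla f(w,s)^{\odot2}\|\bigr)\le\kappa(x,s)\|u-w\|$$ for all $s\in\Xi$ and all $u,w$ in the open ball $B(x,\rho)$. Put $F(x)=\mathbb E_\xi f(x,\xi)$ and $S(x)=\mathbb E_\xi\nabla f(x,\xi)^{\odot2}$. 2. *(Coercivity.)* $F(x)\to+\infty$ as $\|x\|\to\infty$.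 3. *(Coefficients.)* $\mathsf h,\mathsf r,\mathsf p,\mathsf q:(0,\infty)\to[0,\infty)$ are continuous; $\mathsf h$ is $C^1$ with $\dot{\mathsf h}\le0$; $\mathsf r,\mathsf q$ are non-increasing; as $t\to\infty$ the four functions converge to $h_\infty,r_\infty,p_\infty,q_\infty$ respectively, with $h_\infty,r_\infty,q_\infty>0$; $\mathsf r(t)\ge\mathsf q(t)/4$ for all $t>0$ and $r_\infty>q_\infty/4$. 4. *(Stepsizes.)* $\gamma_n>0$ for $n\ge1$, $\gamma_{n+1}/\gamma_n\to1$ and $\sum_n\gamma_n=+\infty$. Put $\tau_n=\sum_{k=1}^n\gamma_k$; let $h_0,r_0,p_0,q_0>0$ and, for $n\ge1$, $h_n=\mathsf h(\tau_n)$, $r_n=\mathsf r(\tau_n)$, $p_n=\mathsf p(\tau_n)$, $q_n=\mathsf q(\tau_n)$. Moreover $1-\gamma_{n+1}q_n\ge0$ for all $n\ge0$. 5. *(Noise.)* Either (i) there is a real $q\ge2$ such that $\sup_{x\in K}\mathbb E_\xi\|\nabla f(x,\xi)\|^{2q}<\infty$ for every compact $K\subset\mathbb R^d$, and $\sum_n\gamma_n^{1+q/2}<\infty$;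 or (ii) for every compact $K\subset\mathbb R^d$ there is a real $\sigma_K\ne0$ such that for all $x\in K$ and $u\in\mathbb R^d$ both $\mathbb E_\xi\exp\langle u,\nabla f(x,\xi)-\nabla F(x)\rangle$ and $\mathbb E_\xi\exp\langle u,\nabla f(x,\xi)^{\odot2}-S(x)\rangle$ are at most $\exp(\sigma_K^2\|u\|^2/2)$, and $\sum_n\exp(-\alpha/\gamma_n)<\infty$ for every $\alpha>0$. 6. *(Sard-type condition.)* The set $F(\{x:\nabla F(x)=0\})$ has empty interior in $\mathbb R$. Let $(\xi_n)_{n\ge1}$ be i.i.d. random variables with law $\mu$ on a probability space $(\Omega,\mathcal F,\mathbb P)$, let $\varepsilon>0$ and let $z_0=(v_0,m_0,x_0)\in[0,\infty)^d\times\mathbb R^d\times\mathbb R^d$ be deterministic. Define $z_n=(v_n,m_n,x_n)$ for $n\ge0$ by $$\begin{aligned}v_{n+1}&=(1-\gamma_{n+1}q_n)v_n+\gamma_{n+1}p_n\nabla f(x_n,\xi_{n+1})^{\odot2},\\ m_{n+1}&=(1-\gamma_{n+1}r_n)m_n+\gamma_{n+1}h_n\nabla f(x_n,\xi_{n+1}),\\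 x_{n+1}&=x_n-\gamma_{n+1}\,m_{n+1}/\sqrt{v_{n+1}+\varepsilon}.\end{aligned}$$ **Theorem.** Suppose that the sequence $(z_n)$ is bounded with probability one. Then, with probability one, $(z_n)$ converges towards the set $$\Upsilon=\{(p_\infty S(x)/q_\infty,\,0,\,x)\ :\ \nabla F(x)=0\},$$ that is, $\operatorname{dist}(z_n,\Upsilon)\to0$. If, in addition, the set of critical points of $F$ is finite or countable, then, with probability one, $(z_n)$ converges to a single point of $\Upsilon$ (which may depend on the outcome). -/

import Mathlib

open MeasureTheory ProbabilityTheory Filter Topology Set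

noncomputable section

namespace StochAlg

/-- `ℝ^d` with its Euclidean norm. -/
abbrev Vec (d : ℕ) := EuclideanSpace ℝ (Fin d)

/-- The state space `ℝ^d × ℝ^d × ℝ^d` of triples `z = (v, m, x)`. -/
abbrev State (d : ℕ) := Vec d × Vec d × Vec d

/-- The componentwise square `x^{⊙2}`. -/
def sq {d : ℕ} (x : Vec d) : Vec d := WithLp.toLp 2 fun i => x i ^ 2

/-- The componentwise quotient `m / √(v + ε)`. -/
def quot {d : ℕ} (ε : ℝ) (m v : Vec d) : Vec d :=
  WithLp.toLp 2 fun i => m i / Real.sqrt (v i + ε)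

/-- The gradient `∇f(x, s)` with respect to the first variable. -/
def grad {d : ℕ} {Ξ : Type*} (f : Vec d → Ξ → ℝ) (x : Vec d) (s : Ξ) : Vec d :=
  gradient (fun y => f y s) x

/-- The objective function `F(x) = 𝔼_ξ[f(x, ξ)]`. -/
def objective {d : ℕ} {Ξ : Type*} [MeasurableSpace Ξ] (μ : Measure Ξ)
    (f : Vec d → Ξ → ℝ) (x : Vec d) : ℝ :=
  ∫ s, f x s ∂μ

/-- The map `S(x) = 𝔼_ξ[∇f(x, ξ)^{⊙2}]`. -/
def secondMoment {d : ℕ} {Ξ : Type*} [MeasurableSpace Ξ] (μ : Measure Ξ)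
    (f : Vec d → Ξ → ℝ) (x : Vec d) : Vec d :=
  ∫ s, sq (grad f x s) ∂μ

/-- The set of critical points of a function. -/
def criticalSet {d : ℕ} (F : Vec d → ℝ) : Set (Vec d) := {x | gradient F x = 0}

/-- `Υ = {(p_∞ S(x) / q_∞, 0, x) : ∇F(x) = 0}`. -/
def limitSet {d : ℕ} (F : Vec d → ℝ) (S : Vec d → Vec d) (pInf qInf : ℝ) : Set (State d) :=
  {z | ∃ x ∈ criticalSet F, z = ((pInf / qInf) • S x, 0, x)}

/-- Regularity of the model: `f(x, ·)` is integrable, `f(·, s)` is differentiable,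
`∇f(x, ·)^{⊙2}` is integrable, and `∇f(·, s)`, `∇f(·, s)^{⊙2}` are Lipschitz near each point, on a
neighbourhood independent of `s` and with an integrable Lipschitz constant. -/
structure RegularModel {d : ℕ} {Ξ : Type*} [MeasurableSpace Ξ] (μ : Measure Ξ)
    (f : Vec d → Ξ → ℝ) : Prop where
  measurable : Measurable (Function.uncurry f)
  integrable : ∀ x, Integrable (f x) μ
  differentiable : ∀ s, Differentiable ℝ fun x => f x s
  integrable_sq : ∀ x, Integrable (fun s => sq (grad f x s)) μ
  lipschitz : ∃ κ : Vec d → Ξ → ℝ, Measurable (Function.uncurry κ) ∧ (∀ x s, 0 ≤ κ x s) ∧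
    ∀ x, Integrable (κ x) μ ∧ ∃ ρ > 0, ∀ s, ∀ u ∈ Metric.ball x ρ, ∀ w ∈ Metric.ball x ρ,
      max ‖grad f u s - grad f w s‖ ‖sq (grad f u s) - sq (grad f w s)‖ ≤ κ x s * ‖u - w‖

/-- The conditions on the coefficient functions `h, r, p, q : (0, ∞) → [0, ∞)` and their limits. -/
structure Coefficients (h r p q : ℝ → ℝ) (hInf rInf pInf qInf : ℝ) : Prop where
  nonneg : ∀ t, 0 < t → 0 ≤ h t ∧ 0 ≤ r t ∧ 0 ≤ p t ∧ 0 ≤ q t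
  h_contDiff : ContDiffOn ℝ 1 h (Ioi 0)
  r_cont : ContinuousOn r (Ioi 0)
  p_cont : ContinuousOn p (Ioi 0)
  q_cont : ContinuousOn q (Ioi 0)
  h_deriv : ∀ t, 0 < t → deriv h t ≤ 0
  h_lim : Tendsto h atTop (𝓝 hInf)
  hInf_pos : 0 < hInf
  r_anti : AntitoneOn r (Ioi 0)
  q_anti : AntitoneOn q (Ioi 0)
  r_lim : Tendsto r atTop (𝓝 rInf)
  rInf_pos : 0 < rInf
  q_lim : Tendsto q atTop (𝓝 qInf)
  qInf_pos : 0 < qInf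
  p_lim : Tendsto p atTop (𝓝 pInf)
  r_ge : ∀ t, 0 < t → q t / 4 ≤ r t
  rInf_gt : qInf / 4 < rInf

/-- `τ_n = γ_1 + ⋯ + γ_n`. -/
def tau (γ : ℕ → ℝ) (n : ℕ) : ℝ := ∑ k ∈ Finset.Icc 1 n, γ k

/-- Stepsizes `(γ_n)_{n ≥ 1}` (the value `γ 0` is never used): positive, with
`γ_{n+1} / γ_n → 1` and `∑ γ_n = ∞`. -/
structure Stepsizes (γ : ℕ → ℝ) : Prop where
  pos : ∀ n, 1 ≤ n → 0 < γ n
  ratio : Tendsto (fun n => γ (n + 1) / γ n) atTop (𝓝 1)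
  diverges : Tendsto (tau γ) atTop atTop

/-- The coefficient sequence `a_n = a(τ_n)` for `n ≥ 1`, with a prescribed value `a_0`. -/
def coeffSeq (γ : ℕ → ℝ) (a0 : ℝ) (a : ℝ → ℝ) (n : ℕ) : ℝ :=
  if n = 0 then a0 else a (tau γ n)

/-- The moment condition on the noise, with the corresponding condition on the stepsizes. -/
def MomentCondition {d : ℕ} {Ξ : Type*} [MeasurableSpace Ξ] (μ : Measure Ξ)
    (f : Vec d → Ξ → ℝ) (γ : ℕ → ℝ) : Prop :=
  ∃ q : ℝ, 2 ≤ q ∧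
    (∀ K : Set (Vec d), IsCompact K →
      (⨆ x ∈ K, ∫⁻ s, ‖grad f x s‖ₑ ^ (2 * q) ∂μ) < ⊤) ∧
    Summable fun n => γ (n + 1) ^ (1 + q / 2)

/-- The sub-Gaussian condition on the noise, with the corresponding condition on the stepsizes. -/
def SubGaussianCondition {d : ℕ} {Ξ : Type*} [MeasurableSpace Ξ] (μ : Measure Ξ)
    (f : Vec d → Ξ → ℝ) (γ : ℕ → ℝ) : Prop :=
  (∀ K : Set (Vec d), IsCompact K → ∃ σ : ℝ, σ ≠ 0 ∧ ∀ x ∈ K, ∀ u : Vec d,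
    ∫⁻ s, ENNReal.ofReal (Real.exp (inner ℝ u (grad f x s - gradient (objective μ f) x))) ∂μ
        ≤ ENNReal.ofReal (Real.exp (σ ^ 2 * ‖u‖ ^ 2 / 2)) ∧
    ∫⁻ s, ENNReal.ofReal (Real.exp (inner ℝ u (sq (grad f x s) - secondMoment μ f x))) ∂μ
        ≤ ENNReal.ofReal (Real.exp (σ ^ 2 * ‖u‖ ^ 2 / 2))) ∧
  ∀ α : ℝ, 0 < α → Summable fun n => Real.exp (-α / γ (n + 1))

/-- One iteration of the algorithm from `z = (v, m, x)`, with stepsize `γ`, coefficients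
`h, r, p, q` and noise sample `s`. -/
def step {d : ℕ} {Ξ : Type*} (f : Vec d → Ξ → ℝ) (ε γ h r p q : ℝ) (s : Ξ) (z : State d) :
    State d :=
  let v' := (1 - γ * q) • z.1 + (γ * p) • sq (grad f z.2.2 s)
  let m' := (1 - γ * r) • z.2.1 + (γ * h) • grad f z.2.2 s
  (v', m', z.2.2 - γ • quot ε m' v')

/-- The iterates `z_n = (v_n, m_n, x_n)`: `z_{n+1}` is computed from `z_n` with the stepsize
`γ_{n+1}`, the coefficients `h_n, r_n, p_n, q_n` and the sample `ξ_{n+1}`. -/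
def iterate {d : ℕ} {Ξ : Type*} (f : Vec d → Ξ → ℝ) (ε : ℝ) (γ h r p q : ℕ → ℝ) (ξ : ℕ → Ξ)
    (z0 : State d) : ℕ → State d
  | 0 => z0
  | n + 1 => step f ε (γ (n + 1)) (h n) (r n) (p n) (q n) (ξ (n + 1))
      (iterate f ε γ h r p q ξ z0 n)

end StochAlg

end

/-! With steps `Γ n = γ (n + 1)`, the algorithm is a noisy Euler scheme for v' = p_∞ S(x) - q_∞ v,
m' = h_∞ ∇F(x) - r_∞ m, x' = -m / √(v + ε). The argument works on the sequences themselves; no flow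
of the differential equation is needed.

Noise. Let a_{n+1} = (1 - Γ_n) a_n + Γ_n h_n (∇f(x_n, ξ_{n+1}) - ∇F(x_n)), and let b be its analogue
for the squared gradients. On bounded trajectories a and b tend to 0 almost surely
(`ae_tendsto_discountedSum_noise`). Indeed, cut the indices into blocks of Γ-length between 1 and 2.
By a maximal inequality and Borel-Cantelli the noise summed inside a block is eventually small, and
each block shrinks the earlier contribution by a factor at least 2. Hence V = v - b and M = m - a
follow the Euler scheme with drift errors that tend to 0 (`exists_perturbedSystem`).

Lyapunov function. Take W = h_∞ F(x) + ∑ m_i² / (2 √(v_i + ε)) - δ ⟨∇F(x), m⟩. The first two terms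
exchange h_∞ ⟨∇F(x), m / √(v + ε)⟩ and leave a damping in m because r_∞ > q_∞ / 4; the cross term,
with δ small, adds a damping in ∇F(x). So W decreases at rate at least c (‖m‖² + ‖∇F(x)‖²), up to
o(Γ_n) (`exists_descent`). The values of W where this rate vanishes lie in h_∞ F({∇F = 0}), a set
with empty interior, so W cannot oscillate across an interval and must converge
(`exists_tendsto_lyapunov`). A convergent W leaves no room for dissipation: m and ∇F(x) tend to 0
(`tendsto_zero_of_lyapunov`), and v is then attracted by p_∞ S(x) / q_∞ (`tendsto_V_sub`).

Compactness gives convergence to the limit set. Since the increments of x vanish, the limit points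
of x cannot form a countable set without x converging (`exists_tendsto_of_countable`). -/

noncomputable section

namespace StochAlg

/-! ### Differentiation under the expectation. -/

section Model

variable {d : ℕ} {Ξ : Type*} [MeasurableSpace Ξ] {μ : Measure Ξ} {f : Vec d → Ξ → ℝ}

lemma RegularModel.hasGradientAt (hf : RegularModel μ f) (x : Vec d) (s : Ξ) :
    HasGradientAt (fun y => f y s) (grad f x s) x :=
  (hf.differentiable s x).hasGradientAt

lemma measurable_sq : Measurable (sq : Vec d → Vec d) := by
  unfold sq
  fun_prop

lemma sq_apply (x : Vec d) (i : Fin d) : sq x i = x i ^ 2 := rfl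

lemma quot_apply (ε : ℝ) (m v : Vec d) (i : Fin d) :
    quot ε m v i = m i / Real.sqrt (v i + ε) := rfl

/-- The partial derivatives are limits of difference quotients, hence jointly measurable. -/
lemma RegularModel.measurable_grad (hf : RegularModel μ f) :
    Measurable (Function.uncurry (grad f)) := by
  have key : ∀ i : Fin d, Measurable fun a : Vec d × Ξ => grad f a.1 a.2 i := by
    intro i
    refine measurable_of_tendsto_metrizable
      (f := fun (n : ℕ) (a : Vec d × Ξ) => ((n : ℝ) + 1) *
        (f (a.1 + ((n : ℝ) + 1)⁻¹ • EuclideanSpace.single i (1 : ℝ)) a.2 - f a.1 a.2)) ?_ ?_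
    · intro n
      refine Measurable.const_mul (Measurable.sub ?_ hf.measurable) _
      exact hf.measurable.comp ((measurable_fst.add_const _).prodMk measurable_snd)
    · rw [tendsto_pi_nhds]
      rintro ⟨x, s⟩
      have h1 := (hf.hasGradientAt x s).hasFDerivAt.hasLineDerivAt (EuclideanSpace.single i (1 : ℝ))
      have h2 : ((InnerProductSpace.toDual ℝ (Vec d)) (grad f x s))
          (EuclideanSpace.single i (1 : ℝ)) = grad f x s i := by
        simp [EuclideanSpace.inner_single_right]
      rw [h2] at h1
      have h3 := h1.tendsto_slope_zero_right
      have h4 : Tendsto (fun n : ℕ => ((n : ℝ) + 1)⁻¹) atTop (𝓝[>] 0) := by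
        refine tendsto_nhdsWithin_iff.2 ⟨?_, Eventually.of_forall fun n => ?_⟩
        · simpa [one_div] using tendsto_one_div_add_atTop_nhds_zero_nat (𝕜 := ℝ)
        · simp only [mem_Ioi]; positivity
      have h5 := h3.comp h4
      refine h5.congr fun n => ?_
      simp
  have : Function.uncurry (grad f)
      = fun a : Vec d × Ξ => WithLp.toLp 2 (fun i => grad f a.1 a.2 i) := by
    ext a; rfl
  rw [this]
  exact (WithLp.measurable_toLp 2 _).comp (measurable_pi_lambda _ key)

lemma RegularModel.measurable_grad_right (hf : RegularModel μ f) (x : Vec d) :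
    Measurable (grad f x) :=
  hf.measurable_grad.comp measurable_prodMk_left

lemma abs_sq_apply_le (x : Vec d) : ∀ i, |sq x i| ≤ ‖x‖ ^ 2 := by
  intro i
  rw [sq_apply, abs_pow]
  gcongr
  simpa using PiLp.norm_apply_le x i

lemma norm_sq_eq_sum_sq_apply (x : Vec d) : ‖x‖ ^ 2 = ∑ i, sq x i := by
  rw [EuclideanSpace.norm_sq_eq]
  simp [sq_apply]

/-- ‖∇f‖ ≤ 1 + ‖∇f‖², and ‖∇f‖² is the sum of the coordinates of the integrable field ∇f^{⊙2}. -/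
lemma RegularModel.integrable_grad [IsFiniteMeasure μ] (hf : RegularModel μ f) (x : Vec d) :
    Integrable (grad f x) μ := by
  have h1 : Integrable (fun s => 1 + ∑ i, sq (grad f x s) i) μ := by
    refine (integrable_const _).add (integrable_finsetSum _ fun i _ => ?_)
    exact (EuclideanSpace.proj (𝕜 := ℝ) i).integrable_comp (hf.integrable_sq x)
  refine h1.mono' (hf.measurable_grad_right x).aestronglyMeasurable (ae_of_all _ fun s => ?_)
  rw [← norm_sq_eq_sum_sq_apply]
  nlinarith [sq_nonneg (‖grad f x s‖ - 1), norm_nonneg (grad f x s)]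

/-- The local Lipschitz bound gives ‖∇f(y, s)‖ ≤ ‖∇f(x, s)‖ + κ(x, s) ρ on the ball around x, an
integrable domination that is uniform in y. -/
lemma RegularModel.hasGradientAt_objective [IsFiniteMeasure μ] (hf : RegularModel μ f)
    (x : Vec d) : HasGradientAt (objective μ f) (∫ s, grad f x s ∂μ) x := by
  obtain ⟨κ, -, hκ0, hκ⟩ := hf.lipschitz
  obtain ⟨hκi, ρ, hρ, hL⟩ := hκ x
  rw [hasGradientAt_iff_hasFDerivAt]
  have hint := hf.integrable_grad x
  have key := hasFDerivAt_integral_of_dominated_of_fderiv_le (𝕜 := ℝ) (μ := μ) (F := f)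
    (F' := fun y s => InnerProductSpace.toDual ℝ (Vec d) (grad f y s)) (x₀ := x)
    (bound := fun s => ‖grad f x s‖ + κ x s * ρ) (Metric.ball_mem_nhds x hρ)
    (Eventually.of_forall fun y => (hf.integrable y).aestronglyMeasurable) (hf.integrable x)
    ((InnerProductSpace.toDual ℝ (Vec d)).continuous.comp_aestronglyMeasurable
      hint.aestronglyMeasurable)
    (ae_of_all _ fun s y hy => ?_) (hint.norm.add (hκi.mul_const ρ))
    (ae_of_all _ fun s y _ => (hf.hasGradientAt y s).hasFDerivAt)
  · have e : ∫ s, (InnerProductSpace.toDual ℝ (Vec d)) (grad f x s) ∂μ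
        = (InnerProductSpace.toDual ℝ (Vec d)) (∫ s, grad f x s ∂μ) :=
      (InnerProductSpace.toDual ℝ (Vec d)).toContinuousLinearEquiv.toContinuousLinearMap.integral_comp_comm
        hint
    rw [e] at key
    exact key
  · rw [LinearIsometryEquiv.norm_map]
    have h1 := (le_max_left _ _).trans (hL s y hy x (Metric.mem_ball_self hρ))
    have h2 : ‖y - x‖ ≤ ρ := by rw [← dist_eq_norm]; exact (Metric.mem_ball.1 hy).le
    calc ‖grad f y s‖ = ‖grad f x s + (grad f y s - grad f x s)‖ := by congr 1; abel
      _ ≤ ‖grad f x s‖ + ‖grad f y s - grad f x s‖ := norm_add_le _ _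
      _ ≤ ‖grad f x s‖ + κ x s * ρ := by
        gcongr
        exact h1.trans (mul_le_mul_of_nonneg_left h2 (hκ0 x s))

lemma RegularModel.gradient_objective [IsFiniteMeasure μ] (hf : RegularModel μ f) (x : Vec d) :
    gradient (objective μ f) x = ∫ s, grad f x s ∂μ :=
  (hf.hasGradientAt_objective x).gradient

lemma locallyLipschitz_integral {E : Type*} [NormedAddCommGroup E] [NormedSpace ℝ E]
    {G : Vec d → Ξ → E} (hG : ∀ x, Integrable (G x) μ) {κ : Vec d → Ξ → ℝ}
    (h : ∀ x, Integrable (κ x) μ ∧ ∃ ρ > 0, ∀ s, ∀ u ∈ Metric.ball x ρ, ∀ w ∈ Metric.ball x ρ,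
      ‖G u s - G w s‖ ≤ κ x s * ‖u - w‖) :
    LocallyLipschitz fun x => ∫ s, G x s ∂μ := by
  intro x
  obtain ⟨hκ, ρ, hρ, hL⟩ := h x
  refine ⟨Real.toNNReal (∫ s, κ x s ∂μ), Metric.ball x ρ, Metric.ball_mem_nhds x hρ, ?_⟩
  refine LipschitzOnWith.of_dist_le_mul fun u hu w hw => ?_
  rw [dist_eq_norm, dist_eq_norm, ← integral_sub (hG u) (hG w)]
  calc ‖∫ s, G u s - G w s ∂μ‖ ≤ ∫ s, κ x s * ‖u - w‖ ∂μ :=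
        norm_integral_le_of_norm_le (hκ.mul_const _) (ae_of_all _ fun s => hL s u hu w hw)
    _ = (∫ s, κ x s ∂μ) * ‖u - w‖ := integral_mul_const _ _
    _ ≤ _ := by gcongr; exact Real.le_coe_toNNReal _

lemma RegularModel.locallyLipschitz_gradient [IsFiniteMeasure μ] (hf : RegularModel μ f) :
    LocallyLipschitz (gradient (objective μ f)) := by
  obtain ⟨κ, -, -, hκ⟩ := hf.lipschitz
  rw [funext hf.gradient_objective]
  refine locallyLipschitz_integral hf.integrable_grad (κ := κ) fun x => ?_
  obtain ⟨hi, ρ, hρ, h⟩ := hκ x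
  exact ⟨hi, ρ, hρ, fun s u hu w hw => (le_max_left _ _).trans (h s u hu w hw)⟩

lemma RegularModel.locallyLipschitz_secondMoment (hf : RegularModel μ f) :
    LocallyLipschitz (secondMoment μ f) := by
  obtain ⟨κ, -, -, hκ⟩ := hf.lipschitz
  refine locallyLipschitz_integral hf.integrable_sq (κ := κ) fun x => ?_
  obtain ⟨hi, ρ, hρ, h⟩ := hκ x
  exact ⟨hi, ρ, hρ, fun s u hu w hw => (le_max_right _ _).trans (h s u hu w hw)⟩

end Model

/-! ### Discounted sums and blocks of indices. -/

section Sums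

/-- The discounted sums `N_{n+1} = (1 - Γ_n) N_n + T_n`, `N_0 = 0`. -/
def discountedSum {E : Type*} [AddCommGroup E] [Module ℝ E] (Γ : ℕ → ℝ) (T : ℕ → E) : ℕ → E
  | 0 => 0
  | n + 1 => (1 - Γ n) • discountedSum Γ T n + T n

lemma discountedSum_apply {d : ℕ} (Γ : ℕ → ℝ) (T : ℕ → Vec d) (n : ℕ) (i : Fin d) :
    discountedSum Γ T n i = discountedSum Γ (fun k => T k i) n := by
  induction n with
  | zero => rfl
  | succ n ih => simp [discountedSum, ih]

/-- The partial sums of `T` from the index `n` on, frozen as soon as they reach `α` in absolute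
value. -/
def stoppedSum (α : ℝ) (T : ℕ → ℝ) (n : ℕ) : ℕ → ℝ
  | 0 => 0
  | j + 1 => stoppedSum α T n j + (if |stoppedSum α T n j| < α then T (n + j) else 0)

/-- This plays the role of a maximal inequality: freezing the sum once it reaches the level turns an
event about all times up to `l` into an event about time `l` alone. -/
lemma le_abs_stoppedSum {α : ℝ} {T : ℕ → ℝ} {n j l : ℕ} (hjl : j ≤ l)
    (h : α ≤ |∑ i ∈ Finset.range j, T (n + i)|) : α ≤ |stoppedSum α T n l| := by
  have h1 : ∀ j, stoppedSum α T n j = ∑ i ∈ Finset.range j, T (n + i) ∨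
      α ≤ |stoppedSum α T n j| := by
    intro j
    induction j with
    | zero => left; simp [stoppedSum]
    | succ j ih =>
      by_cases hj : |stoppedSum α T n j| < α
      · left
        rcases ih with ih | ih
        · rw [stoppedSum, if_pos hj, Finset.sum_range_succ, ih]
        · exact absurd hj (not_lt.2 ih)
      · right
        rw [stoppedSum, if_neg hj, add_zero]
        exact not_lt.1 hj
  induction l, hjl using Nat.le_induction with
  | base =>
    rcases h1 j with h2 | h2
    · rwa [h2]
    · exact h2
  | succ l _ ih => rwa [stoppedSum, if_neg (not_lt.2 ih), add_zero]

/-- Consecutive blocks of indices along which `Γ` sums up to a number between `1` and `2`. -/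
structure IsBlocks (Γ : ℕ → ℝ) (N₀ : ℕ) (φ l : ℕ → ℕ) : Prop where
  start : φ 0 = N₀
  next : ∀ k, φ (k + 1) = φ k + l k
  one_le : ∀ k, 1 ≤ ∑ i ∈ Finset.range (l k), Γ (φ k + i)
  le_two : ∀ k, ∑ i ∈ Finset.range (l k), Γ (φ k + i) ≤ 2

lemma IsBlocks.length_pos {Γ : ℕ → ℝ} {N₀ : ℕ} {φ l : ℕ → ℕ} (h : IsBlocks Γ N₀ φ l) (k : ℕ) :
    0 < l k := by
  rcases Nat.eq_zero_or_pos (l k) with h0 | h0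
  · have := h.one_le k
    rw [h0] at this
    norm_num at this
  · exact h0

lemma IsBlocks.monotone {Γ : ℕ → ℝ} {N₀ : ℕ} {φ l : ℕ → ℕ} (h : IsBlocks Γ N₀ φ l) :
    Monotone φ :=
  monotone_nat_of_le_succ fun k => by rw [h.next]; exact Nat.le_add_right _ _

lemma IsBlocks.start_le {Γ : ℕ → ℝ} {N₀ : ℕ} {φ l : ℕ → ℕ} (h : IsBlocks Γ N₀ φ l) (k : ℕ) :
    N₀ ≤ φ k := h.start ▸ h.monotone (Nat.zero_le k)

lemma IsBlocks.exists_block {Γ : ℕ → ℝ} {N₀ : ℕ} {φ l : ℕ → ℕ} (h : IsBlocks Γ N₀ φ l)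
    {k₁ n : ℕ} (hn : φ k₁ ≤ n) : ∃ k ≥ k₁, ∃ j < l k, n = φ k + j := by
  induction n, hn using Nat.le_induction with
  | base => exact ⟨k₁, le_rfl, 0, h.length_pos k₁, rfl⟩
  | succ n _ ih =>
    obtain ⟨k, hk, j, hj, rfl⟩ := ih
    rcases Nat.lt_or_ge (j + 1) (l k) with h1 | h1
    · exact ⟨k, hk, j + 1, h1, rfl⟩
    · refine ⟨k + 1, by omega, 0, h.length_pos _, ?_⟩
      rw [h.next]; omega

lemma tendsto_sum_range_add {Γ : ℕ → ℝ}
    (hdiv : Tendsto (fun n => ∑ i ∈ Finset.range n, Γ i) atTop atTop) (n : ℕ) :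
    Tendsto (fun l => ∑ i ∈ Finset.range l, Γ (n + i)) atTop atTop := by
  have h1 : Tendsto (fun l => ∑ i ∈ Finset.range (n + l), Γ i) atTop atTop :=
    hdiv.comp (tendsto_add_atTop_nat n |>.congr fun l => by omega)
  simp only [Finset.sum_range_add] at h1
  exact tendsto_atTop_add_const_left _ (-∑ i ∈ Finset.range n, Γ i) h1 |>.congr fun l => by ring

/-- Stop at the first index where the sum reaches `t`; the overshoot is at most the last term, hence
at most `t`. -/
lemma exists_sum_range_mem_Icc {Γ : ℕ → ℝ} {n : ℕ} {t : ℝ} (ht : 0 ≤ t)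
    (hΓ : ∀ k ≥ n, Γ k ≤ t)
    (hdiv : Tendsto (fun n => ∑ i ∈ Finset.range n, Γ i) atTop atTop) :
    ∃ l, t ≤ ∑ i ∈ Finset.range l, Γ (n + i) ∧ ∑ i ∈ Finset.range l, Γ (n + i) ≤ 2 * t := by
  classical
  have hex : ∃ l, t ≤ ∑ i ∈ Finset.range l, Γ (n + i) :=
    ((tendsto_sum_range_add hdiv n).eventually_ge_atTop t).exists
  refine ⟨Nat.find hex, Nat.find_spec hex, ?_⟩
  rcases hl : Nat.find hex with _ | l
  · simpa using ht
  · have h1 : ¬ t ≤ ∑ i ∈ Finset.range l, Γ (n + i) := Nat.find_min hex (by omega)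
    rw [Finset.sum_range_succ]
    linarith [hΓ (n + l) (by omega)]

lemma exists_isBlocks {Γ : ℕ → ℝ} {N₀ : ℕ} (hΓ1 : ∀ n ≥ N₀, Γ n ≤ 1)
    (hdiv : Tendsto (fun n => ∑ i ∈ Finset.range n, Γ i) atTop atTop) :
    ∃ φ l : ℕ → ℕ, IsBlocks Γ N₀ φ l := by
  have key : ∀ n, ∃ l, N₀ ≤ n → 1 ≤ ∑ i ∈ Finset.range l, Γ (n + i) ∧
      ∑ i ∈ Finset.range l, Γ (n + i) ≤ 2 := by
    intro n
    by_cases hn : N₀ ≤ n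
    · obtain ⟨l, h1, h2⟩ := exists_sum_range_mem_Icc zero_le_one
        (fun k hk => hΓ1 k (hn.trans hk)) hdiv
      exact ⟨l, fun _ => ⟨h1, by linarith⟩⟩
    · exact ⟨0, fun h => absurd h hn⟩
  choose L hL using key
  let φ : ℕ → ℕ := fun k => Nat.rec N₀ (fun _ a => a + L a) k
  have hφ : ∀ k, N₀ ≤ φ k := by
    intro k
    induction k with
    | zero => exact le_rfl
    | succ k ih => exact ih.trans (Nat.le_add_right _ _)
  exact ⟨φ, fun k => L (φ k), rfl, fun k => rfl, fun k => (hL _ (hφ k)).1,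
    fun k => (hL _ (hφ k)).2⟩

/-- The blocks tile the indices from `N₀` on, so sums over blocks telescope into partial sums of
`β`. -/
lemma IsBlocks.summable_sum {Γ : ℕ → ℝ} {N₀ : ℕ} {φ l : ℕ → ℕ} (h : IsBlocks Γ N₀ φ l)
    {β : ℕ → ℝ} (hβ : ∀ n, 0 ≤ β n) (hs : Summable β) :
    Summable fun k => ∑ i ∈ Finset.range (l k), β (φ k + i) := by
  refine summable_of_sum_range_le (c := ∑' n, β n)
    (fun k => Finset.sum_nonneg fun i _ => hβ _) fun K => ?_
  have h1 : ∀ K, ∑ i ∈ Finset.range (φ 0), β i +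
      ∑ k ∈ Finset.range K, ∑ i ∈ Finset.range (l k), β (φ k + i)
      = ∑ i ∈ Finset.range (φ K), β i := by
    intro K
    induction K with
    | zero => simp
    | succ K ih => rw [Finset.sum_range_succ, ← add_assoc, ih, h.next, Finset.sum_range_add]
  have h2 := hs.sum_le_tsum (Finset.range (φ K)) fun i _ => hβ i
  have h3 : 0 ≤ ∑ i ∈ Finset.range (φ 0), β i := Finset.sum_nonneg fun i _ => hβ _
  linarith [h1 K]

/-- Inside a block, let Y be the partial sum of `T` and D = N - Y. Then D_{j+1} = (1 - Γ) D_j - Γ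
Y_j, and |Y| < δ gives |D| ≤ exp(-Γ-length) |N(start)| + δ: the errors do not accumulate because (1
- Γ) δ + Γ δ = δ. A whole block has Γ-length at least 1, so it contracts the starting value by e⁻¹ ≤
1/2. -/
lemma IsBlocks.tendsto_discountedSum {Γ : ℕ → ℝ} {N₀ : ℕ} {φ l : ℕ → ℕ}
    (h : IsBlocks Γ N₀ φ l) (hΓ1 : ∀ n ≥ N₀, Γ n ≤ 1) (hΓ0 : ∀ n, 0 ≤ Γ n) {T : ℕ → ℝ}
    (hT : ∀ δ > 0, ∀ᶠ k in atTop, ∀ j ≤ l k, |∑ i ∈ Finset.range j, T (φ k + i)| < δ) :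
    Tendsto (discountedSum Γ T) atTop (𝓝 0) := by
  set N := discountedSum Γ T with hN
  rw [Metric.tendsto_atTop]
  intro δ' hδ'
  -- The final bound is δ (geometric part) + 4δ (block starts) + 2δ (inside a block) = 7δ.
  obtain ⟨δ, hδ, rfl⟩ : ∃ δ > 0, δ' = 8 * δ := ⟨δ' / 8, by positivity, by ring⟩
  obtain ⟨k₀, hk₀⟩ := eventually_atTop.1 (hT δ hδ)
  have hblock : ∀ k ≥ k₀, ∀ j ≤ l k, |N (φ k + j)| ≤
      Real.exp (-∑ i ∈ Finset.range j, Γ (φ k + i)) * |N (φ k)| + 2 * δ := by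
    intro k hk
    have hD : ∀ j ≤ l k, |N (φ k + j) - ∑ i ∈ Finset.range j, T (φ k + i)| ≤
        Real.exp (-∑ i ∈ Finset.range j, Γ (φ k + i)) * |N (φ k)| + δ := by
      intro j
      induction j with
      | zero => intro _; simp; positivity
      | succ j ih =>
        intro hj
        have ih := ih (by omega)
        have hY := (hk₀ k hk j (by omega)).le
        set Y := ∑ i ∈ Finset.range j, T (φ k + i)
        set g := Γ (φ k + j)
        have hg1 : g ≤ 1 := hΓ1 _ ((h.start_le k).trans (Nat.le_add_right _ _))
        have hg0 : 0 ≤ g := hΓ0 _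
        have e1 : N (φ k + (j + 1)) - ∑ i ∈ Finset.range (j + 1), T (φ k + i)
            = (1 - g) * (N (φ k + j) - Y) - g * Y := by
          rw [Finset.sum_range_succ, ← add_assoc, hN, discountedSum]
          simp only [smul_eq_mul]
          ring
        rw [e1, Finset.sum_range_succ, neg_add, Real.exp_add]
        set a := Real.exp (-∑ i ∈ Finset.range j, Γ (φ k + i))
        have ha : 0 < a := Real.exp_pos _
        have hexp : 1 - g ≤ Real.exp (-g) := by linarith [Real.add_one_le_exp (-g)]
        calc |(1 - g) * (N (φ k + j) - Y) - g * Y|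
            ≤ |(1 - g) * (N (φ k + j) - Y)| + |g * Y| := abs_sub _ _
          _ = (1 - g) * |N (φ k + j) - Y| + g * |Y| := by
              rw [abs_mul, abs_mul, abs_of_nonneg hg0, abs_of_nonneg (by linarith : 0 ≤ 1 - g)]
          _ ≤ (1 - g) * (a * |N (φ k)| + δ) + g * δ := by
              gcongr
          _ = (1 - g) * (a * |N (φ k)|) + δ := by ring
          _ ≤ Real.exp (-g) * (a * |N (φ k)|) + δ := by gcongr
          _ = a * Real.exp (-g) * |N (φ k)| + δ := by ring
    intro j hj
    have h1 := hD j hj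
    have h2 := (hk₀ k hk j hj).le
    have h3 := abs_sub_abs_le_abs_sub (N (φ k + j)) (∑ i ∈ Finset.range j, T (φ k + i))
    linarith
  have hexp1 : Real.exp (-1) ≤ 1 / 2 := by
    rw [Real.exp_neg, one_div]
    exact inv_anti₀ (by norm_num) (by linarith [Real.add_one_le_exp (1 : ℝ)])
  -- 4δ is the fixed point of t ↦ t / 2 + 2δ.
  have hstart : ∀ j, |N (φ (k₀ + j))| ≤ (1 / 2) ^ j * |N (φ k₀)| + 4 * δ := by
    intro j
    induction j with
    | zero => simp; positivity
    | succ j ih =>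
      have h1 := hblock (k₀ + j) (by omega) _ le_rfl
      rw [← h.next] at h1
      have h2 : Real.exp (-∑ i ∈ Finset.range (l (k₀ + j)), Γ (φ (k₀ + j) + i)) ≤ 1 / 2 :=
        (Real.exp_le_exp.2 (by linarith [h.one_le (k₀ + j)])).trans hexp1
      have h3 := mul_le_mul_of_nonneg_right h2 (abs_nonneg (N (φ (k₀ + j))))
      rw [← add_assoc, pow_succ]
      linarith
  have hlim : Tendsto (fun j : ℕ => (1 / 2 : ℝ) ^ j * |N (φ k₀)|) atTop (𝓝 0) := by
    have := (tendsto_pow_atTop_nhds_zero_of_lt_one (r := (1 / 2 : ℝ)) (by norm_num)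
      (by norm_num)).mul_const |N (φ k₀)|
    simpa using this
  obtain ⟨j₀, hj₀⟩ := eventually_atTop.1 (hlim.eventually_lt_const hδ)
  refine ⟨φ (k₀ + j₀), fun n hn => ?_⟩
  obtain ⟨k, hk, j, hj, rfl⟩ := h.exists_block hn
  obtain ⟨i, rfl⟩ : ∃ i, k = k₀ + i := ⟨k - k₀, by omega⟩
  have h1 := hblock (k₀ + i) (by omega) j hj.le
  have h2 := hstart i
  have h3 := hj₀ i (by omega)
  have h4 : Real.exp (-∑ i_1 ∈ Finset.range j, Γ (φ (k₀ + i) + i_1)) ≤ 1 :=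
    Real.exp_le_one_iff.2 (neg_nonpos.2 (Finset.sum_nonneg fun _ _ => hΓ0 _))
  have h5 := mul_le_mul_of_nonneg_right h4 (abs_nonneg (N (φ (k₀ + i))))
  rw [Real.dist_eq, sub_zero]
  linarith

end Sums

/-! ### The filtration of the samples and conditioning on the past. -/

section Past

variable {Ω Ξ : Type*} [mΞ : MeasurableSpace Ξ]

/-- The `σ`-algebra generated by `ζ_0, …, ζ_{k-1}`. -/
@[reducible] def past (ζ : ℕ → Ω → Ξ) (k : ℕ) : MeasurableSpace Ω :=
  ⨆ i ∈ Iio k, MeasurableSpace.comap (ζ i) mΞ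

lemma past_mono (ζ : ℕ → Ω → Ξ) {k l : ℕ} (h : k ≤ l) : past ζ k ≤ past ζ l :=
  biSup_mono fun _ hi => lt_of_lt_of_le hi h

lemma measurable_past (ζ : ℕ → Ω → Ξ) {i k : ℕ} (h : i < k) : Measurable[past ζ k] (ζ i) :=
  measurable_iff_comap_le.2 (le_iSup₂_of_le i h le_rfl)

lemma measurable_stoppedSum {ζ : ℕ → Ω → Ξ} {T : ℕ → Ω → ℝ}
    (hT : ∀ k, Measurable[past ζ (k + 1)] (T k)) (α : ℝ) (n j : ℕ) :
    Measurable[past ζ (n + j)] fun ω => stoppedSum α (fun k => T k ω) n j := by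
  induction j with
  | zero => exact measurable_const
  | succ j ih =>
    have ih' := ih.mono (past_mono ζ (Nat.le_succ (n + j))) le_rfl
    refine Measurable.add ih' (Measurable.ite ?_ (hT _) measurable_const)
    have : Measurable[past ζ (n + j + 1)]
        fun ω => |stoppedSum α (fun k => T k ω) n j| :=
      continuous_abs.measurable.comp ih'
    exact this measurableSet_Iio

variable {ζ : ℕ → Ω → Ξ} {E : Type*} [MeasurableSpace E] {X : ℕ → Ω → E} {H : E → Ξ → ℝ} {c : ℕ → ℝ}

lemma measurable_increment (hX : ∀ k, Measurable[past ζ k] (X k))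
    (hH : Measurable (Function.uncurry H)) (k : ℕ) :
    Measurable[past ζ (k + 1)] fun ω => c k * H (X k ω) (ζ k ω) :=
  Measurable.const_mul (hH.comp (((hX k).mono (past_mono ζ (Nat.le_succ k)) le_rfl).prodMk
    (measurable_past ζ (Nat.lt_succ_self k)))) _

variable [mΩ : MeasurableSpace Ω]

lemma past_le (hζ : ∀ n, Measurable (ζ n)) (k : ℕ) : past ζ k ≤ mΩ :=
  iSup₂_le fun i _ => (hζ i).comap_le

/-- Averaging over the sample `ζ_k`, which is independent of the past. -/
lemma lintegral_past {P : Measure Ω} [IsProbabilityMeasure P] {μ : Measure Ξ}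
    (hζ : ∀ n, Measurable (ζ n)) (hlaw : ∀ n, P.map (ζ n) = μ)
    (hind : iIndepFun ζ P) {k : ℕ} {X : Ω → E}
    (hX : Measurable[past ζ k] X) {Φ : E × Ξ → ENNReal} (hΦ : Measurable Φ) :
    ∫⁻ ω, Φ (X ω, ζ k ω) ∂P = ∫⁻ ω, ∫⁻ s, Φ (X ω, s) ∂μ ∂P := by
  have hX' : Measurable X := hX.mono (past_le hζ k) le_rfl
  have h1 : Indep (past ζ k) (⨆ i ∈ ({k} : Set ℕ), MeasurableSpace.comap (ζ i) mΞ) P :=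
    indep_iSup_of_disjoint (fun i => (hζ i).comap_le) hind (by simp)
  have h2 : IndepFun X (ζ k) P := by
    refine indep_of_indep_of_le_right (indep_of_indep_of_le_left h1 ?_) ?_
    · exact measurable_iff_comap_le.1 hX
    · exact le_iSup₂_of_le k (mem_singleton k) le_rfl
  have h3 := (indepFun_iff_map_prod_eq_prod_map_map hX'.aemeasurable (hζ k).aemeasurable).1 h2
  rw [hlaw k] at h3
  have : IsProbabilityMeasure μ := hlaw k ▸ Measure.isProbabilityMeasure_map (hζ k).aemeasurable
  rw [← lintegral_map (f := Φ) hΦ (hX'.prodMk (hζ k)), h3,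
    lintegral_prod _ hΦ.aemeasurable, lintegral_map hΦ.lintegral_prod_right' hX']

variable {P : Measure Ω} [IsProbabilityMeasure P] {μ : Measure Ξ} [IsProbabilityMeasure μ]

/-- Whether the sum is already frozen is decided by the past, so the fresh sample can be averaged
out with the past held fixed. On the frozen part nothing changes, and `1 ≤ A` makes the bound
trivial there. -/
lemma lintegral_stoppedSum_succ_le (hζ : ∀ n, Measurable (ζ n)) (hlaw : ∀ n, P.map (ζ n) = μ)
    (hind : iIndepFun ζ P) (hX : ∀ k, Measurable[past ζ k] (X k))
    (hH : Measurable (Function.uncurry H)) (α : ℝ) (n j : ℕ) {Ψ : ℝ → ENNReal}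
    (hΨ : Measurable Ψ) {A B : ENNReal} (hA : 1 ≤ A)
    (hstep : ∀ x y, ∫⁻ s, Ψ (y + c (n + j) * H x s) ∂μ ≤ A * Ψ y + B) :
    ∫⁻ ω, Ψ (stoppedSum α (fun k => c k * H (X k ω) (ζ k ω)) n (j + 1)) ∂P ≤
      A * ∫⁻ ω, Ψ (stoppedSum α (fun k => c k * H (X k ω) (ζ k ω)) n j) ∂P + B := by
  set T : ℕ → Ω → ℝ := fun k ω => c k * H (X k ω) (ζ k ω)
  have hYm := measurable_stoppedSum (measurable_increment (c := c) hX hH) α n j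
  have hY' : Measurable fun ω => stoppedSum α (fun k => T k ω) n j :=
    hYm.mono (past_le hζ _) le_rfl
  let Φ : (E × ℝ) × Ξ → ENNReal := fun a =>
    Ψ (a.1.2 + if |a.1.2| < α then c (n + j) * H a.1.1 a.2 else 0)
  have hΦ : Measurable Φ := by
    refine hΨ.comp (Measurable.add (by fun_prop) (Measurable.ite ?_ ?_ measurable_const))
    · exact measurableSet_lt (by fun_prop) measurable_const
    · exact Measurable.const_mul (hH.comp (measurable_fst.fst.prodMk measurable_snd)) _
  have h1 := lintegral_past hζ hlaw hind ((hX (n + j)).prodMk hYm) hΦ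
  calc _ = ∫⁻ ω, ∫⁻ s, Φ ((X (n + j) ω, stoppedSum α (fun k => T k ω) n j), s) ∂μ ∂P := h1
    _ ≤ ∫⁻ ω, (A * Ψ (stoppedSum α (fun k => T k ω) n j) + B) ∂P := by
        refine lintegral_mono fun ω => ?_
        by_cases hlt : |stoppedSum α (fun k => T k ω) n j| < α
        · simp only [Φ, if_pos hlt]
          exact hstep _ _
        · simp only [Φ, if_neg hlt, add_zero, lintegral_const, measure_univ, mul_one]
          exact le_add_right (le_mul_of_one_le_left' hA)
    _ = _ := by
        rw [lintegral_add_right _ measurable_const,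
          lintegral_const_mul _ (f := fun ω => Ψ _) (hΨ.comp hY')]
        simp [T]

end Past

/-! ### One-step inequalities for moments of order q. -/

section BlockBounds

/-- Two regimes. If |t| ≤ 1/q, then (1 + t)^q ≤ exp(qt) ≤ 1 + qt + (qt)². Otherwise |1 + t| ≤ (q +
1)|t|, the last term alone suffices, and 1 + qt + q²t² is nonnegative. -/
lemma abs_one_add_rpow_le {q : ℝ} (hq : 1 ≤ q) (t : ℝ) :
    |1 + t| ^ q ≤ 1 + q * t + q ^ 2 * t ^ 2 + (q + 1) ^ q * |t| ^ q := by
  have hq0 : 0 < q := by linarith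
  have hlast : 0 ≤ (q + 1) ^ q * |t| ^ q := by positivity
  rcases le_or_gt |t| (1 / q) with h | h
  · have hqt : |q * t| ≤ 1 := by
      rw [abs_mul, abs_of_pos hq0]
      calc q * |t| ≤ q * (1 / q) := by gcongr
        _ = 1 := by field_simp
    have ht1 : |t| ≤ 1 := h.trans (by rw [div_le_one hq0]; exact hq)
    have h0 : 0 ≤ 1 + t := by linarith [neg_abs_le t]
    have h1 : (1 + t) ^ q ≤ Real.exp (q * t) := by
      calc (1 + t) ^ q ≤ (Real.exp t) ^ q := by
            gcongr
            linarith [Real.add_one_le_exp t]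
        _ = Real.exp (q * t) := by rw [← Real.exp_mul, mul_comm]
    have h2 := Real.abs_exp_sub_one_sub_id_le hqt
    have h3 := le_abs_self (Real.exp (q * t) - 1 - q * t)
    rw [abs_of_nonneg h0]
    nlinarith
  · have h1 : 1 ≤ q * |t| := by
      rw [div_lt_iff₀ hq0] at h
      linarith
    have h2 : |1 + t| ≤ (q + 1) * |t| := by
      calc |1 + t| ≤ |1| + |t| := abs_add_le _ _
        _ ≤ (q + 1) * |t| := by rw [abs_one]; linarith
    have h3 : |1 + t| ^ q ≤ (q + 1) ^ q * |t| ^ q := by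
      rw [← Real.mul_rpow (by positivity) (abs_nonneg t)]
      gcongr
    nlinarith [sq_nonneg (q * t + 1), sq_nonneg (q * t)]

/-- By homogeneity this is the previous inequality at t = b / a. What matters is that the
first-order term is linear in `b`, so that it disappears under a centred expectation; for `a = 0`
division by zero makes it vanish. -/
lemma abs_add_rpow_le {q : ℝ} (hq : 2 ≤ q) (a b : ℝ) :
    |a + b| ^ q ≤ |a| ^ q + q * |a| ^ q / a * b + q ^ 2 * |a| ^ (q - 2) * b ^ 2
      + (q + 1) ^ q * |b| ^ q := by
  rcases eq_or_ne a 0 with rfl | ha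
  · have h1 : 1 ≤ (q + 1) ^ q := Real.one_le_rpow (by linarith) (by linarith)
    have h2 : 0 ≤ |b| ^ q := by positivity
    have h3 : 0 ≤ q ^ 2 * |(0 : ℝ)| ^ (q - 2) * b ^ 2 := by positivity
    have h4 : |(0 : ℝ)| ^ q = 0 := by rw [abs_zero, Real.zero_rpow (by linarith)]
    rw [zero_add, h4]
    simp only [div_zero, zero_mul]
    nlinarith
  · have h1 := abs_one_add_rpow_le (by linarith : 1 ≤ q) (b / a)
    have hpos : 0 < |a| := abs_pos.2 ha
    have h2 : |a + b| ^ q = |a| ^ q * |1 + b / a| ^ q := by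
      rw [← Real.mul_rpow (abs_nonneg _) (abs_nonneg _), ← abs_mul]
      congr 2
      field_simp
    have h3 : |a| ^ (q - 2) = |a| ^ q / a ^ 2 := by
      rw [Real.rpow_sub hpos, Real.rpow_two, sq_abs]
    have h4 : |b| ^ q = |a| ^ q * |b / a| ^ q := by
      rw [← Real.mul_rpow (abs_nonneg _) (abs_nonneg _), ← abs_mul]
      congr 2
      field_simp
    rw [h2, h3, h4]
    refine (mul_le_mul_of_nonneg_left h1 (by positivity)).trans (le_of_eq ?_)
    field_simp

/-- Either g ≤ y² or y² < g, and each case is covered by one term on the right. Multiplied by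
another factor g, it turns the second-order term g² |y|^{q-2} into a Gronwall term g |y|^q plus
g^{1+q/2}, the power that is summable. -/
lemma mul_abs_rpow_sub_two_le {q : ℝ} (hq : 2 ≤ q) {g : ℝ} (hg : 0 < g) (y : ℝ) :
    g * |y| ^ (q - 2) ≤ |y| ^ q + g ^ (q / 2) := by
  have h0 : 0 ≤ |y| ^ q := by positivity
  have h0' : 0 ≤ g ^ (q / 2) := by positivity
  rcases le_or_gt g (|y| ^ 2) with h | h
  · have hy : 0 < |y| := by
      rcases (abs_nonneg y).eq_or_lt with h1 | h1
      · rw [← h1] at h; norm_num at h; linarith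
      · exact h1
    have : |y| ^ q = |y| ^ 2 * |y| ^ (q - 2) := by
      rw [← Real.rpow_two, ← Real.rpow_add hy]; congr 1; ring
    have h2 : g * |y| ^ (q - 2) ≤ |y| ^ 2 * |y| ^ (q - 2) := by gcongr
    linarith
  · have h1 : |y| ≤ g ^ (1 / 2 : ℝ) := by
      rw [← Real.sqrt_eq_rpow]
      exact Real.le_sqrt_of_sq_le h.le
    have h2 : |y| ^ (q - 2) ≤ g ^ ((q - 2) / 2) := by
      calc |y| ^ (q - 2) ≤ (g ^ (1 / 2 : ℝ)) ^ (q - 2) :=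
            Real.rpow_le_rpow (abs_nonneg y) h1 (by linarith)
        _ = g ^ ((q - 2) / 2) := by rw [← Real.rpow_mul hg.le]; congr 1; ring
    have h3 : g ^ (q / 2) = g * g ^ ((q - 2) / 2) := by
      nth_rewrite 2 [← Real.rpow_one g]
      rw [← Real.rpow_add hg]; congr 1; ring
    have h4 : g * |y| ^ (q - 2) ≤ g * g ^ ((q - 2) / 2) := by gcongr
    linarith

variable {Ξ : Type*} [MeasurableSpace Ξ] {μ : Measure Ξ} [IsProbabilityMeasure μ]

/-- The linear term integrates to zero, and Z² ≤ 1 + |Z|^q bounds the second moment by 1 + C. -/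
lemma lintegral_abs_add_rpow_le {q C : ℝ} (hq : 2 ≤ q) {Z : Ξ → ℝ} (hZ : Measurable Z)
    (hmean : ∫ s, Z s ∂μ = 0) (hC : 0 ≤ C)
    (hmom : ∫⁻ s, ENNReal.ofReal (|Z s| ^ q) ∂μ ≤ ENNReal.ofReal C) (c y : ℝ) :
    ∫⁻ s, ENNReal.ofReal (|y + c * Z s| ^ q) ∂μ ≤
      ENNReal.ofReal (|y| ^ q + q ^ 2 * |y| ^ (q - 2) * c ^ 2 * (1 + C)
        + (q + 1) ^ q * |c| ^ q * C) := by
  have hq0 : 0 < q := by linarith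
  have hmq : Measurable fun s => |Z s| ^ q := (continuous_abs.measurable.comp hZ).pow_const q
  have hiq : Integrable (fun s => |Z s| ^ q) μ := by
    refine ⟨hmq.aestronglyMeasurable, ?_⟩
    rw [hasFiniteIntegral_iff_ofReal (ae_of_all _ fun s => by positivity)]
    exact hmom.trans_lt ENNReal.ofReal_lt_top
  have hIq : ∫ s, |Z s| ^ q ∂μ ≤ C := by
    rw [integral_eq_lintegral_of_nonneg_ae (ae_of_all _ fun s => by positivity)
      hmq.aestronglyMeasurable]
    exact ENNReal.toReal_le_of_le_ofReal hC hmom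
  have hle2 : ∀ s, Z s ^ 2 ≤ 1 + |Z s| ^ q := by
    intro s
    rw [← sq_abs]
    rcases le_or_gt |Z s| 1 with h | h
    · have : |Z s| ^ 2 ≤ 1 := pow_le_one₀ (abs_nonneg _) h
      have : 0 ≤ |Z s| ^ q := by positivity
      linarith
    · have := Real.rpow_le_rpow_of_exponent_le h.le hq
      rw [Real.rpow_two] at this
      linarith
  have hi2 : Integrable (fun s => Z s ^ 2) μ := by
    refine ((integrable_const 1).add hiq).mono' (hZ.pow_const 2).aestronglyMeasurable
      (ae_of_all _ fun s => ?_)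
    rw [Real.norm_of_nonneg (sq_nonneg _)]
    exact hle2 s
  have hI2 : ∫ s, Z s ^ 2 ∂μ ≤ 1 + C := by
    calc ∫ s, Z s ^ 2 ∂μ ≤ ∫ s, (1 + |Z s| ^ q) ∂μ :=
          integral_mono hi2 ((integrable_const 1).add hiq) hle2
      _ = 1 + ∫ s, |Z s| ^ q ∂μ := by
          rw [integral_add (integrable_const 1) hiq]; simp
      _ ≤ 1 + C := by linarith
  have hi1 : Integrable Z μ := by
    refine ((integrable_const 1).add hi2).mono' hZ.aestronglyMeasurable (ae_of_all _ fun s => ?_)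
    simp only [Real.norm_eq_abs, Pi.add_apply]
    nlinarith [sq_abs (Z s), sq_nonneg (|Z s| - 1), abs_nonneg (Z s)]
  set B : Ξ → ℝ := fun s => |y| ^ q + q * |y| ^ q / y * c * Z s +
    q ^ 2 * |y| ^ (q - 2) * c ^ 2 * Z s ^ 2 + (q + 1) ^ q * |c| ^ q * |Z s| ^ q with hB
  have hptw : ∀ s, |y + c * Z s| ^ q ≤ B s := by
    intro s
    refine (abs_add_rpow_le hq y (c * Z s)).trans (le_of_eq ?_)
    rw [hB, abs_mul, Real.mul_rpow (abs_nonneg _) (abs_nonneg _)]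
    ring
  have hBi1 : Integrable (fun s => |y| ^ q + q * |y| ^ q / y * c * Z s) μ :=
    (integrable_const _).add (hi1.const_mul _)
  have hBi2 : Integrable (fun s => |y| ^ q + q * |y| ^ q / y * c * Z s +
      q ^ 2 * |y| ^ (q - 2) * c ^ 2 * Z s ^ 2) μ :=
    hBi1.add (hi2.const_mul (q ^ 2 * |y| ^ (q - 2) * c ^ 2))
  have hBi : Integrable B μ := hBi2.add (hiq.const_mul ((q + 1) ^ q * |c| ^ q))
  have hBI : ∫ s, B s ∂μ ≤ |y| ^ q + q ^ 2 * |y| ^ (q - 2) * c ^ 2 * (1 + C)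
        + (q + 1) ^ q * |c| ^ q * C := by
    have : ∫ s, B s ∂μ = |y| ^ q + q * |y| ^ q / y * c * ∫ s, Z s ∂μ +
        q ^ 2 * |y| ^ (q - 2) * c ^ 2 * ∫ s, Z s ^ 2 ∂μ +
        (q + 1) ^ q * |c| ^ q * ∫ s, |Z s| ^ q ∂μ := by
      rw [← integral_const_mul, ← integral_const_mul, ← integral_const_mul]
      rw [show |y| ^ q = ∫ s : Ξ, |y| ^ q ∂μ by simp]
      rw [← integral_add (integrable_const _) (hi1.const_mul _)]
      rw [← integral_add, ← integral_add]
      · simp [hB]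
      · simpa using hBi2
      · exact hiq.const_mul _
      · simpa using hBi1
      · exact hi2.const_mul _
    rw [this, hmean, mul_zero, add_zero]
    gcongr
  calc ∫⁻ s, ENNReal.ofReal (|y + c * Z s| ^ q) ∂μ ≤ ∫⁻ s, ENNReal.ofReal (B s) ∂μ :=
        lintegral_mono fun s => ENNReal.ofReal_le_ofReal (hptw s)
    _ = ENNReal.ofReal (∫ s, B s ∂μ) :=
        (ofReal_integral_eq_lintegral_ofReal hBi (ae_of_all _ fun s =>
          (by positivity : 0 ≤ |y + c * Z s| ^ q).trans (hptw s))).symm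
    _ ≤ _ := ENNReal.ofReal_le_ofReal hBI

end BlockBounds

/-! ### Maximal bounds on blocks and Borel-Cantelli. -/

section NoiseBounds

variable {Ω Ξ : Type*} [MeasurableSpace Ω] [MeasurableSpace Ξ] {P : Measure Ω} {Γ : ℕ → ℝ}

/-- The probability that partial sums of `T` over a block of `Γ`-length at most `2` get as large as
`α` is bounded by the sum over the block of a summable sequence. -/
def HasBlockBound (P : Measure Ω) (Γ : ℕ → ℝ) (T : ℕ → Ω → ℝ) (N₀ : ℕ) (α : ℝ) : Prop :=
  ∃ β : ℕ → ℝ, (∀ n, 0 ≤ β n) ∧ Summable β ∧ ∀ n l, N₀ ≤ n →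
    ∑ i ∈ Finset.range l, Γ (n + i) ≤ 2 →
    P {ω | ∃ j ≤ l, α ≤ |∑ i ∈ Finset.range j, T (n + i) ω|} ≤
      ENNReal.ofReal (∑ i ∈ Finset.range l, β (n + i))

/-- Borel-Cantelli over the blocks, applied to the countably many levels 1/(a+1): the exceptional
probabilities are sums of `β` over disjoint blocks, hence summable. -/
lemma ae_tendsto_discountedSum {T : ℕ → Ω → ℝ} (hΓ0 : ∀ n, 0 ≤ Γ n) {N₀ : ℕ}
    (hΓ1 : ∀ n ≥ N₀, Γ n ≤ 1)
    (hdiv : Tendsto (fun n => ∑ i ∈ Finset.range n, Γ i) atTop atTop)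
    (hT : ∀ α > 0, HasBlockBound P Γ T N₀ α) :
    ∀ᵐ ω ∂P, Tendsto (discountedSum Γ fun k => T k ω) atTop (𝓝 0) := by
  obtain ⟨φ, l, hb⟩ := exists_isBlocks hΓ1 hdiv
  have key : ∀ a : ℕ, ∀ᵐ ω ∂P, ∀ᶠ k in atTop,
      ω ∉ {ω | ∃ j ≤ l k, 1 / ((a : ℝ) + 1) ≤ |∑ i ∈ Finset.range j, T (φ k + i) ω|} := by
    intro a
    obtain ⟨β, hβ0, hβs, hβ⟩ := hT (1 / ((a : ℝ) + 1)) (by positivity)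
    refine ae_eventually_notMem (ne_top_of_le_ne_top ?_ (ENNReal.tsum_le_tsum fun k =>
      hβ (φ k) (l k) (hb.start_le k) (hb.le_two k)))
    exact (hb.summable_sum hβ0 hβs).tsum_ofReal_ne_top
  filter_upwards [ae_all_iff.2 key] with ω hω
  refine hb.tendsto_discountedSum hΓ1 hΓ0 fun δ hδ => ?_
  obtain ⟨a, ha⟩ := exists_nat_one_div_lt hδ
  filter_upwards [hω a] with k hk j hj
  by_contra hcon
  exact hk ⟨j, hj, ha.le.trans (not_lt.1 hcon)⟩

variable [IsProbabilityMeasure P] {μ : Measure Ξ} [IsProbabilityMeasure μ]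
  {ζ : ℕ → Ω → Ξ} {E : Type*} [MeasurableSpace E] {X : ℕ → Ω → E} {H : E → Ξ → ℝ}
  {c : ℕ → ℝ} {A : ℝ}

/-- The stopped sums satisfy E|Y_{j+1}|^q ≤ (1 + C₁ Γ) E|Y_j|^q + C₂ Γ^{1+q/2} with Y_0 = 0. A
discrete Gronwall argument costs at most exp(2 C₁) over a block of Γ-length at most 2, and Markov's
inequality at the end of the block concludes. -/
lemma hasBlockBound_of_moment (hζ : ∀ n, Measurable (ζ n)) (hlaw : ∀ n, P.map (ζ n) = μ)
    (hind : iIndepFun ζ P) (hX : ∀ k, Measurable[past ζ k] (X k))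
    (hH : Measurable (Function.uncurry H)) {N₀ : ℕ} (hΓ0 : ∀ n, 0 < Γ n)
    (hΓ1 : ∀ n ≥ N₀, Γ n ≤ 1) (hA : 0 ≤ A) (hc : ∀ n, |c n| ≤ A * Γ n)
    {q C : ℝ} (hq : 2 ≤ q) (hC : 0 ≤ C) (hmean : ∀ x, ∫ s, H x s ∂μ = 0)
    (hmom : ∀ x, ∫⁻ s, ENNReal.ofReal (|H x s| ^ q) ∂μ ≤ ENNReal.ofReal C)
    (hsum : Summable fun n => Γ n ^ (1 + q / 2)) {α : ℝ} (hα : 0 < α) :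
    HasBlockBound P Γ (fun k ω => c k * H (X k ω) (ζ k ω)) N₀ α := by
  have hq0 : 0 < q := by linarith
  set C₁ : ℝ := q ^ 2 * A ^ 2 * (1 + C) with hC₁
  set C₂ : ℝ := C₁ + (q + 1) ^ q * A ^ q * C with hC₂
  have hC₁0 : 0 ≤ C₁ := by positivity
  have hC₂0 : 0 ≤ C₂ := by positivity
  set T : ℕ → Ω → ℝ := fun k ω => c k * H (X k ω) (ζ k ω) with hT
  set Ψ : ℝ → ENNReal := fun y => ENNReal.ofReal (|y| ^ q) with hΨ
  have hΨm : Measurable Ψ := by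
    refine ENNReal.measurable_ofReal.comp (Measurable.pow_const continuous_abs.measurable q)
  have hone : ∀ k ≥ N₀, ∀ x y, ∫⁻ s, Ψ (y + c k * H x s) ∂μ ≤
      ENNReal.ofReal (1 + C₁ * Γ k) * Ψ y + ENNReal.ofReal (C₂ * Γ k ^ (1 + q / 2)) := by
    intro k hk x y
    refine (lintegral_abs_add_rpow_le hq (hH.comp measurable_prodMk_left) (hmean x) hC (hmom x)
      (c k) y).trans ?_
    have hg := hΓ0 k
    have hg1 := hΓ1 k hk
    rw [hΨ, ← ENNReal.ofReal_mul (by positivity), ← ENNReal.ofReal_add (by positivity)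
      (by positivity)]
    refine ENNReal.ofReal_le_ofReal ?_
    have h1 : c k ^ 2 ≤ A ^ 2 * Γ k ^ 2 := by
      rw [← sq_abs, ← mul_pow]
      exact pow_le_pow_left₀ (abs_nonneg _) (hc k) 2
    have h2 : |c k| ^ q ≤ A ^ q * Γ k ^ (1 + q / 2) := by
      calc |c k| ^ q ≤ (A * Γ k) ^ q := Real.rpow_le_rpow (abs_nonneg _) (hc k) hq0.le
        _ = A ^ q * Γ k ^ q := Real.mul_rpow hA hg.le
        _ ≤ A ^ q * Γ k ^ (1 + q / 2) := by
          have := Real.rpow_le_rpow_of_exponent_ge hg hg1 (by linarith : 1 + q / 2 ≤ q)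
          gcongr
    have h3 := mul_abs_rpow_sub_two_le hq hg y
    have h4 : Γ k ^ (1 + q / 2) = Γ k * Γ k ^ (q / 2) := by
      rw [Real.rpow_add hg, Real.rpow_one]
    have h5 : q ^ 2 * |y| ^ (q - 2) * c k ^ 2 * (1 + C) ≤
        C₁ * Γ k * (|y| ^ q + Γ k ^ (q / 2)) := by
      calc q ^ 2 * |y| ^ (q - 2) * c k ^ 2 * (1 + C)
          ≤ q ^ 2 * |y| ^ (q - 2) * (A ^ 2 * Γ k ^ 2) * (1 + C) := by gcongr
        _ = C₁ * Γ k * (Γ k * |y| ^ (q - 2)) := by rw [hC₁]; ring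
        _ ≤ _ := by gcongr
    have h6 : (q + 1) ^ q * |c k| ^ q * C ≤ (q + 1) ^ q * (A ^ q * Γ k ^ (1 + q / 2)) * C := by
      gcongr
    calc |y| ^ q + q ^ 2 * |y| ^ (q - 2) * c k ^ 2 * (1 + C) + (q + 1) ^ q * |c k| ^ q * C
        ≤ |y| ^ q + C₁ * Γ k * (|y| ^ q + Γ k ^ (q / 2)) +
          (q + 1) ^ q * (A ^ q * Γ k ^ (1 + q / 2)) * C := by linarith
      _ = (1 + C₁ * Γ k) * |y| ^ q + C₂ * Γ k ^ (1 + q / 2) := by rw [hC₂, h4]; ring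
  have hgron : ∀ n ≥ N₀, ∀ l, ∫⁻ ω, Ψ (stoppedSum α (fun k => T k ω) n l) ∂P ≤
      ENNReal.ofReal (Real.exp (C₁ * ∑ i ∈ Finset.range l, Γ (n + i)) *
        ∑ i ∈ Finset.range l, C₂ * Γ (n + i) ^ (1 + q / 2)) := by
    intro n hn l
    induction l with
    | zero => simp [stoppedSum, hΨ, Real.zero_rpow hq0.ne']
    | succ l ih =>
      have hg := hΓ0 (n + l)
      have hS : 0 ≤ ∑ i ∈ Finset.range l, C₂ * Γ (n + i) ^ (1 + q / 2) :=
        Finset.sum_nonneg fun i _ => by have := hΓ0 (n + i); positivity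
      have hG : 0 ≤ ∑ i ∈ Finset.range (l + 1), Γ (n + i) :=
        Finset.sum_nonneg fun i _ => (hΓ0 _).le
      refine (lintegral_stoppedSum_succ_le hζ hlaw hind hX hH α n l hΨm
        (A := ENNReal.ofReal (1 + C₁ * Γ (n + l)))
        (B := ENNReal.ofReal (C₂ * Γ (n + l) ^ (1 + q / 2))) ?_ (hone (n + l) (by omega))).trans ?_
      · rw [ENNReal.one_le_ofReal]
        have : 0 ≤ C₁ * Γ (n + l) := by positivity
        linarith
      · refine (add_le_add_left (mul_le_mul_right ih _) _).trans ?_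
        rw [← ENNReal.ofReal_mul (by positivity), ← ENNReal.ofReal_add (by positivity)
          (by positivity)]
        refine ENNReal.ofReal_le_ofReal ?_
        have h1 : Real.exp (C₁ * ∑ i ∈ Finset.range (l + 1), Γ (n + i)) =
            Real.exp (C₁ * Γ (n + l)) * Real.exp (C₁ * ∑ i ∈ Finset.range l, Γ (n + i)) := by
          rw [Finset.sum_range_succ, mul_add, Real.exp_add, mul_comm]
        have h2 : 1 ≤ Real.exp (C₁ * ∑ i ∈ Finset.range (l + 1), Γ (n + i)) :=
          Real.one_le_exp (by positivity)
        have h3 : 1 + C₁ * Γ (n + l) ≤ Real.exp (C₁ * Γ (n + l)) := by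
          linarith [Real.add_one_le_exp (C₁ * Γ (n + l))]
        have h4 : 0 ≤ C₂ * Γ (n + l) ^ (1 + q / 2) := by positivity
        rw [Finset.sum_range_succ (fun i => C₂ * Γ (n + i) ^ (1 + q / 2)), mul_add]
        refine add_le_add ?_ (le_mul_of_one_le_left h4 h2)
        rw [← mul_assoc, h1]
        gcongr
  refine ⟨fun n => Real.exp (C₁ * 2) * C₂ / α ^ q * Γ n ^ (1 + q / 2), fun n => ?_,
    hsum.mul_left _, fun n l hn hl => ?_⟩
  · have := hΓ0 n
    positivity
  · have hαq : 0 < α ^ q := by positivity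
    have h1 : {ω | ∃ j ≤ l, α ≤ |∑ i ∈ Finset.range j, T (n + i) ω|} ⊆
        {ω | ENNReal.ofReal (α ^ q) ≤ Ψ (stoppedSum α (fun k => T k ω) n l)} := by
      rintro ω ⟨j, hj, h⟩
      have h2 := le_abs_stoppedSum (T := fun k => T k ω) hj h
      exact ENNReal.ofReal_le_ofReal (Real.rpow_le_rpow hα.le h2 hq0.le)
    have hYm : Measurable fun ω => stoppedSum α (fun k => T k ω) n l :=
      (measurable_stoppedSum (measurable_increment (c := c) hX hH) α n l).mono
        (past_le hζ _) le_rfl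
    refine (measure_mono h1).trans ?_
    refine (meas_ge_le_lintegral_div (hΨm.comp hYm).aemeasurable (by simpa using hαq)
      ENNReal.ofReal_ne_top).trans ?_
    refine (ENNReal.div_le_div_right (hgron n hn l) _).trans ?_
    rw [← ENNReal.ofReal_div_of_pos hαq]
    refine ENNReal.ofReal_le_ofReal ?_
    have hS : 0 ≤ ∑ i ∈ Finset.range l, Γ (n + i) ^ (1 + q / 2) :=
      Finset.sum_nonneg fun i _ => by have := hΓ0 (n + i); positivity
    rw [← Finset.mul_sum, ← Finset.mul_sum]
    calc Real.exp (C₁ * ∑ i ∈ Finset.range l, Γ (n + i)) *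
          (C₂ * ∑ i ∈ Finset.range l, Γ (n + i) ^ (1 + q / 2)) / α ^ q
        ≤ Real.exp (C₁ * 2) * (C₂ * ∑ i ∈ Finset.range l, Γ (n + i) ^ (1 + q / 2)) / α ^ q := by
          gcongr
      _ = _ := by ring

/-- The stopped sum has exponential moments at most exp(B u² ∑ Γ² / 2), and ∑ Γ² ≤ 2θ for θ the
largest step in the block. Chernoff's bound on both sides gives 2 exp(-α² / (4Bθ)), which is already
one of the terms of the sum over the block. -/
lemma hasBlockBound_of_subGaussian (hζ : ∀ n, Measurable (ζ n)) (hlaw : ∀ n, P.map (ζ n) = μ)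
    (hind : iIndepFun ζ P) (hX : ∀ k, Measurable[past ζ k] (X k))
    (hH : Measurable (Function.uncurry H)) {N₀ : ℕ} (hΓ0 : ∀ n, 0 < Γ n)
    (hA : 0 < A) (hc : ∀ n, |c n| ≤ A * Γ n) {σ : ℝ} (hσ : σ ≠ 0)
    (hexp : ∀ x u, ∫⁻ s, ENNReal.ofReal (Real.exp (u * H x s)) ∂μ ≤
      ENNReal.ofReal (Real.exp (σ ^ 2 * u ^ 2 / 2)))
    (hsum : ∀ a : ℝ, 0 < a → Summable fun n => Real.exp (-a / Γ n)) {α : ℝ} (hα : 0 < α) :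
    HasBlockBound P Γ (fun k ω => c k * H (X k ω) (ζ k ω)) N₀ α := by
  set B : ℝ := σ ^ 2 * A ^ 2 with hB
  have hB0 : 0 < B := by positivity
  set T : ℕ → Ω → ℝ := fun k ω => c k * H (X k ω) (ζ k ω) with hT
  have hYm : ∀ n l, Measurable fun ω => stoppedSum α (fun k => T k ω) n l := fun n l =>
    (measurable_stoppedSum (measurable_increment (c := c) hX hH) α n l).mono (past_le hζ _) le_rfl
  have hΨm : ∀ u : ℝ, Measurable fun y : ℝ => ENNReal.ofReal (Real.exp (u * y)) := fun u => by
    fun_prop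
  have hmgf : ∀ u n l, ∫⁻ ω, ENNReal.ofReal
        (Real.exp (u * stoppedSum α (fun k => T k ω) n l)) ∂P ≤
      ENNReal.ofReal (Real.exp (B * u ^ 2 / 2 * ∑ i ∈ Finset.range l, Γ (n + i) ^ 2)) := by
    intro u n l
    induction l with
    | zero => simp [stoppedSum]
    | succ l ih =>
      refine (lintegral_stoppedSum_succ_le hζ hlaw hind hX hH α n l (hΨm u)
        (A := ENNReal.ofReal (Real.exp (B * u ^ 2 / 2 * Γ (n + l) ^ 2)))
        (B := 0) ?_ ?_).trans ?_
      · rw [ENNReal.one_le_ofReal]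
        exact Real.one_le_exp (by positivity)
      · intro x y
        have e : ∀ s, ENNReal.ofReal (Real.exp (u * (y + c (n + l) * H x s))) =
            ENNReal.ofReal (Real.exp (u * y)) *
              ENNReal.ofReal (Real.exp (u * c (n + l) * H x s)) := by
          intro s
          rw [← ENNReal.ofReal_mul (Real.exp_pos _).le, ← Real.exp_add]
          congr 2
          ring
        simp only [e]
        rw [lintegral_const_mul _ (f := fun s => ENNReal.ofReal (Real.exp (u * c (n + l) * H x s)))
            ((hΨm (u * c (n + l))).comp (hH.comp measurable_prodMk_left)),
          add_zero, mul_comm]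
        refine mul_le_mul_left ((hexp x _).trans (ENNReal.ofReal_le_ofReal
          (Real.exp_le_exp.2 ?_))) _
        have h1 : c (n + l) ^ 2 ≤ A ^ 2 * Γ (n + l) ^ 2 := by
          rw [← sq_abs, ← mul_pow]
          exact pow_le_pow_left₀ (abs_nonneg _) (hc _) 2
        calc σ ^ 2 * (u * c (n + l)) ^ 2 / 2 = σ ^ 2 * u ^ 2 / 2 * c (n + l) ^ 2 := by ring
          _ ≤ σ ^ 2 * u ^ 2 / 2 * (A ^ 2 * Γ (n + l) ^ 2) := by gcongr
          _ = _ := by rw [hB]; ring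
      · rw [add_zero]
        refine (mul_le_mul_right ih _).trans ?_
        rw [← ENNReal.ofReal_mul (Real.exp_pos _).le, ← Real.exp_add, Finset.sum_range_succ,
          mul_add, add_comm]
  refine ⟨fun n => 2 * Real.exp (-(α ^ 2 / (4 * B)) / Γ n), fun n => by positivity,
    (hsum _ (by positivity)).mul_left 2, fun n l hn hl => ?_⟩
  have h1 : {ω | ∃ j ≤ l, α ≤ |∑ i ∈ Finset.range j, T (n + i) ω|} ⊆
      {ω | α ≤ |stoppedSum α (fun k => T k ω) n l|} := by
    rintro ω ⟨j, hj, h⟩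
    exact le_abs_stoppedSum (T := fun k => T k ω) hj h
  refine (measure_mono h1).trans ?_
  rcases Nat.eq_zero_or_pos l with rfl | hl0
  · simp [stoppedSum, not_le.2 hα]
  obtain ⟨i₀, hi₀, hmax⟩ := Finset.exists_max_image (Finset.range l) (fun i => Γ (n + i))
    ⟨0, Finset.mem_range.2 hl0⟩
  set θ := Γ (n + i₀) with hθ
  have hθ0 : 0 < θ := hΓ0 _
  -- The minimiser of u ↦ B u² θ - u α.
  set u : ℝ := α / (2 * B * θ) with hu
  have hu0 : 0 < u := by positivity
  have hsq : ∑ i ∈ Finset.range l, Γ (n + i) ^ 2 ≤ 2 * θ := by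
    calc ∑ i ∈ Finset.range l, Γ (n + i) ^ 2 ≤ ∑ i ∈ Finset.range l, Γ (n + i) * θ := by
          refine Finset.sum_le_sum fun i hi => ?_
          rw [pow_two]
          exact mul_le_mul_of_nonneg_left (hmax i hi) (hΓ0 _).le
      _ = (∑ i ∈ Finset.range l, Γ (n + i)) * θ := by rw [Finset.sum_mul]
      _ ≤ 2 * θ := by gcongr
  have htail : ∀ w : ℝ, w ^ 2 = u ^ 2 →
      P {ω | ENNReal.ofReal (Real.exp (u * α)) ≤
        ENNReal.ofReal (Real.exp (w * stoppedSum α (fun k => T k ω) n l))} ≤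
      ENNReal.ofReal (Real.exp (-(α ^ 2 / (4 * B)) / θ)) := by
    intro w hw
    refine (meas_ge_le_lintegral_div ((hΨm w).comp (hYm n l)).aemeasurable
      (by simpa using Real.exp_pos _) ENNReal.ofReal_ne_top).trans ?_
    refine (ENNReal.div_le_div_right (hmgf w n l) _).trans ?_
    rw [← ENNReal.ofReal_div_of_pos (Real.exp_pos _), ← Real.exp_sub, hw]
    refine ENNReal.ofReal_le_ofReal (Real.exp_le_exp.2 ?_)
    calc B * u ^ 2 / 2 * ∑ i ∈ Finset.range l, Γ (n + i) ^ 2 - u * α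
        ≤ B * u ^ 2 / 2 * (2 * θ) - u * α := by gcongr
      _ = -(α ^ 2 / (4 * B)) / θ := by rw [hu]; field_simp; ring
  have h2 : {ω | α ≤ |stoppedSum α (fun k => T k ω) n l|} ⊆
      {ω | ENNReal.ofReal (Real.exp (u * α)) ≤
        ENNReal.ofReal (Real.exp (u * stoppedSum α (fun k => T k ω) n l))} ∪
      {ω | ENNReal.ofReal (Real.exp (u * α)) ≤
        ENNReal.ofReal (Real.exp (-u * stoppedSum α (fun k => T k ω) n l))} := by
    intro ω hω
    rcases le_abs.1 (show α ≤ _ from hω) with h | h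
    · exact Or.inl (ENNReal.ofReal_le_ofReal (Real.exp_le_exp.2 (by gcongr)))
    · refine Or.inr (ENNReal.ofReal_le_ofReal (Real.exp_le_exp.2 ?_))
      nlinarith
  refine (measure_mono h2).trans ((measure_union_le _ _).trans
    ((add_le_add (htail u rfl) (htail (-u) (neg_sq u))).trans ?_))
  rw [← ENNReal.ofReal_add (Real.exp_pos _).le (Real.exp_pos _).le]
  refine ENNReal.ofReal_le_ofReal ?_
  rw [← two_mul]
  exact Finset.single_le_sum (f := fun i => 2 * Real.exp (-(α ^ 2 / (4 * B)) / Γ (n + i)))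
    (fun i _ => by positivity) hi₀

end NoiseBounds

/-! ### The gradient noise along a bounded trajectory. -/

section Noise

variable {d : ℕ} {Ξ : Type*} [MeasurableSpace Ξ] {μ : Measure Ξ} {Γ : ℕ → ℝ}

/-- Either moments bounded on balls, or centred sub-Gaussian tails uniformly on balls, for the
random field `G`, together with the matching condition on the stepsizes. -/
def NoiseCondition (μ : Measure Ξ) (G : Vec d → Ξ → Vec d) (Γ : ℕ → ℝ) : Prop :=
  (∃ q : ℝ, 2 ≤ q ∧ (∀ R : ℝ, ∃ C : ℝ, 0 ≤ C ∧ ∀ x : Vec d, ‖x‖ ≤ R → ∀ i,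
      ∫⁻ s, ENNReal.ofReal (|G x s i| ^ q) ∂μ ≤ ENNReal.ofReal C) ∧
    Summable fun n => Γ n ^ (1 + q / 2)) ∨
  ((∀ R : ℝ, ∃ σ : ℝ, σ ≠ 0 ∧ ∀ x : Vec d, ‖x‖ ≤ R → ∀ u : Vec d,
      ∫⁻ s, ENNReal.ofReal (Real.exp (inner ℝ u (G x s - ∫ t, G x t ∂μ))) ∂μ
        ≤ ENNReal.ofReal (Real.exp (σ ^ 2 * ‖u‖ ^ 2 / 2))) ∧
    ∀ α : ℝ, 0 < α → Summable fun n => Real.exp (-α / Γ n))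

/-- Vanishing of the steps comes from the summability attached to either form of the noise
condition. -/
lemma NoiseCondition.tendsto_zero {G : Vec d → Ξ → Vec d} (h : NoiseCondition μ G Γ)
    (hΓ : ∀ n, 0 < Γ n) : Tendsto Γ atTop (𝓝 0) := by
  have key : ∀ δ > 0, ∀ᶠ n in atTop, Γ n < δ := by
    intro δ hδ
    rcases h with ⟨q, hq, -, hs⟩ | ⟨-, hs⟩
    · have h1 : 0 < δ ^ (1 + q / 2) := by positivity
      filter_upwards [hs.tendsto_atTop_zero.eventually_lt_const h1] with n hn
      exact (Real.rpow_lt_rpow_iff (hΓ n).le hδ.le (by linarith)).1 hn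
    · filter_upwards [(hs 1 one_pos).tendsto_atTop_zero.eventually_lt_const
        (Real.exp_pos (-1 / δ))] with n hn
      rw [Real.exp_lt_exp, neg_div, neg_div, neg_lt_neg_iff] at hn
      exact (one_div_lt_one_div hδ (hΓ n)).1 hn
  rw [Metric.tendsto_atTop]
  intro δ hδ
  obtain ⟨N, hN⟩ := eventually_atTop.1 (key δ hδ)
  refine ⟨N, fun n hn => ?_⟩
  rw [Real.dist_eq, sub_zero, abs_of_pos (hΓ n)]
  exact hN n hn

lemma abs_sub_rpow_le {q : ℝ} (hq : 0 ≤ q) (a b : ℝ) :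
    |a - b| ^ q ≤ 2 ^ q * |a| ^ q + 2 ^ q * |b| ^ q := by
  have ha : 0 ≤ 2 ^ q * |a| ^ q := by positivity
  have hb : 0 ≤ 2 ^ q * |b| ^ q := by positivity
  have h := abs_sub a b
  rw [← Real.mul_rpow (by norm_num) (abs_nonneg _), ← Real.mul_rpow (by norm_num) (abs_nonneg _)]
    at *
  rcases le_total |a| |b| with hab | hab
  · have := Real.rpow_le_rpow (abs_nonneg _) (by linarith : |a - b| ≤ 2 * |b|) hq
    linarith
  · have := Real.rpow_le_rpow (abs_nonneg _) (by linarith : |a - b| ≤ 2 * |a|) hq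
    linarith

lemma integral_apply {G : Ξ → Vec d} (hG : Integrable G μ) (i : Fin d) :
    (∫ s, G s ∂μ) i = ∫ s, G s i ∂μ :=
  ((EuclideanSpace.proj (𝕜 := ℝ) i).integral_comp_comm hG).symm

/-- The discounted sums of the centred noise along a bounded adapted sequence vanish. -/
lemma ae_tendsto_discountedSum_noise {Ω : Type*} [MeasurableSpace Ω] {P : Measure Ω}
    [IsProbabilityMeasure P] [IsProbabilityMeasure μ] {ζ : ℕ → Ω → Ξ}
    (hζ : ∀ n, Measurable (ζ n)) (hlaw : ∀ n, P.map (ζ n) = μ) (hind : iIndepFun ζ P)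
    {X : ℕ → Ω → Vec d} (hX : ∀ k, Measurable[past ζ k] (X k))
    (hΓ : ∀ n, 0 < Γ n) (hdiv : Tendsto (fun n => ∑ i ∈ Finset.range n, Γ i) atTop atTop)
    {G : Vec d → Ξ → Vec d} (hG : Measurable (Function.uncurry G))
    (hint : ∀ x, Integrable (G x) μ) (hcont : Continuous fun x => ∫ s, G x s ∂μ)
    (hnoise : NoiseCondition μ G Γ) {a : ℕ → ℝ} {A : ℝ} (ha : ∀ n, |a n| ≤ A) :
    ∀ᵐ ω ∂P, (∃ R : ℝ, ∀ k, ‖X k ω‖ ≤ R) →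
      Tendsto (discountedSum Γ fun k =>
        (Γ k * a k) • (G (X k ω) (ζ k ω) - ∫ s, G (X k ω) s ∂μ)) atTop (𝓝 0) := by
  obtain ⟨N₀, hN₀⟩ := eventually_atTop.1
    ((hnoise.tendsto_zero hΓ).eventually_le_const (zero_lt_one (α := ℝ)))
  have hA0 : 0 ≤ A := (abs_nonneg _).trans (ha 0)
  have hc : ∀ n, |Γ n * a n| ≤ (A + 1) * Γ n := by
    intro n
    rw [abs_mul, abs_of_pos (hΓ n), mul_comm]
    have := hΓ n
    gcongr
    linarith [ha n]
  -- The noise is set to zero outside the ball of radius `R`, so that the bounds on balls become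
  -- uniform in `x`. On a trajectory bounded by `R` the truncation changes nothing, and natural
  -- radii keep the union of exceptional sets null.
  let H : ℕ → Fin d → Vec d → Ξ → ℝ := fun R i x s =>
    if ‖x‖ ≤ R then G x s i - (∫ t, G x t ∂μ) i else 0
  have hHm : ∀ R i, Measurable (Function.uncurry (H R i)) := by
    intro R i
    refine Measurable.ite (measurableSet_le measurable_fst.norm measurable_const)
      (Measurable.sub ?_ ?_) measurable_const
    · exact (EuclideanSpace.proj (𝕜 := ℝ) i).continuous.measurable.comp hG
    · exact ((EuclideanSpace.proj (𝕜 := ℝ) i).continuous.comp hcont).measurable.comp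
        measurable_fst
  have hblock : ∀ (R : ℕ) (i : Fin d), ∀ α > 0, HasBlockBound P Γ
      (fun k ω => (Γ k * a k) * H R i (X k ω) (ζ k ω)) N₀ α := by
    intro R i α hα
    rcases hnoise with ⟨q, hq, hmom, hs⟩ | ⟨hsub, hs⟩
    · obtain ⟨C, hC, hmom⟩ := hmom R
      obtain ⟨M, hM⟩ := (isCompact_closedBall (0 : Vec d) R).exists_bound_of_continuousOn
        hcont.continuousOn
      have hq0 : 0 ≤ q := by linarith
      refine hasBlockBound_of_moment hζ hlaw hind hX (hHm R i) hΓ hN₀ (by linarith) hc hq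
        (C := 2 ^ q * C + 2 ^ q * |M| ^ q) (by positivity) (fun x => ?_) (fun x => ?_) hs hα
      · by_cases hx : ‖x‖ ≤ R
        · simp only [H, if_pos hx]
          have hi : Integrable (fun s => G x s i) μ :=
            (EuclideanSpace.proj (𝕜 := ℝ) i).integrable_comp (hint x)
          rw [integral_sub hi (integrable_const _), integral_apply (hint x)]
          simp
        · simp [H, if_neg hx]
      · by_cases hx : ‖x‖ ≤ R
        · simp only [H, if_pos hx]
          have hMi : |(∫ t, G x t ∂μ) i| ≤ |M| :=
            ((PiLp.norm_apply_le (∫ t, G x t ∂μ) i).trans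
              (hM x (by simpa using hx))).trans (le_abs_self M)
          calc ∫⁻ s, ENNReal.ofReal (|G x s i - (∫ t, G x t ∂μ) i| ^ q) ∂μ
              ≤ ∫⁻ s, (ENNReal.ofReal (2 ^ q) * ENNReal.ofReal (|G x s i| ^ q) +
                ENNReal.ofReal (2 ^ q * |M| ^ q)) ∂μ := by
                refine lintegral_mono fun s => ?_
                rw [← ENNReal.ofReal_mul (by positivity), ← ENNReal.ofReal_add (by positivity)
                  (by positivity)]
                refine ENNReal.ofReal_le_ofReal ((abs_sub_rpow_le hq0 _ _).trans ?_)
                gcongr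
            _ = ENNReal.ofReal (2 ^ q) * ∫⁻ s, ENNReal.ofReal (|G x s i| ^ q) ∂μ +
                ENNReal.ofReal (2 ^ q * |M| ^ q) := by
                rw [lintegral_add_right _ measurable_const,
                  lintegral_const_mul' _ _ ENNReal.ofReal_ne_top]
                simp
            _ ≤ ENNReal.ofReal (2 ^ q) * ENNReal.ofReal C + ENNReal.ofReal (2 ^ q * |M| ^ q) := by
                gcongr
                exact hmom x hx i
            _ = _ := by
                rw [← ENNReal.ofReal_mul (by positivity), ← ENNReal.ofReal_add (by positivity)
                  (by positivity)]
        · simp only [H, if_neg hx, abs_zero]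
          rw [Real.zero_rpow (by linarith)]
          simp
    · obtain ⟨σ, hσ, hsub⟩ := hsub R
      refine hasBlockBound_of_subGaussian hζ hlaw hind hX (hHm R i) hΓ (by linarith) hc hσ
        (fun x u => ?_) hs hα
      by_cases hx : ‖x‖ ≤ R
      · have h1 := hsub x hx (EuclideanSpace.single i u)
        simp only [H, if_pos hx]
        simpa [EuclideanSpace.inner_single_left, mul_comm] using h1
      · simp only [H, if_neg hx, mul_zero, Real.exp_zero, lintegral_const, measure_univ, mul_one]
        exact ENNReal.ofReal_le_ofReal (Real.one_le_exp (by positivity))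
  have hae : ∀ᵐ ω ∂P, ∀ (R : ℕ) (i : Fin d), Tendsto (discountedSum Γ fun k =>
      (Γ k * a k) * H R i (X k ω) (ζ k ω)) atTop (𝓝 0) := by
    simp only [ae_all_iff]
    exact fun R i => ae_tendsto_discountedSum (fun n => (hΓ n).le) hN₀ hdiv (hblock R i)
  filter_upwards [hae] with ω hω
  rintro ⟨R, hR⟩
  obtain ⟨R', hR'⟩ := exists_nat_ge R
  have hcoord : ∀ i, Tendsto (fun n => discountedSum Γ (fun k =>
        (Γ k * a k) • (G (X k ω) (ζ k ω) - ∫ s, G (X k ω) s ∂μ)) n i) atTop (𝓝 0) := by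
    intro i
    refine (hω R' i).congr fun n => ?_
    rw [discountedSum_apply]
    congr 1
    funext k
    simp [H, if_pos ((hR k).trans hR')]
  have h1 := tendsto_pi_nhds.2 hcoord
  have h2 := ((PiLp.continuous_toLp 2 fun _ : Fin d => ℝ).tendsto 0).comp h1
  exact h2

variable {f : Vec d → Ξ → ℝ} {γ : ℕ → ℝ}

/-- For moments, t ≤ 1 + t² with t = ‖∇f‖^q lets the moment of order 2q control the one of order q.
-/
lemma noiseCondition_grad [IsProbabilityMeasure μ] (hf : RegularModel μ f)
    (h : MomentCondition μ f γ ∨ SubGaussianCondition μ f γ) :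
    NoiseCondition μ (grad f) fun n => γ (n + 1) := by
  rcases h with ⟨q, hq, hK, hs⟩ | ⟨hK, hs⟩
  · refine Or.inl ⟨q, hq, fun R => ?_, hs⟩
    have hK := hK _ (isCompact_closedBall (0 : Vec d) R)
    refine ⟨1 + (⨆ x ∈ Metric.closedBall (0 : Vec d) R,
      ∫⁻ s, ‖grad f x s‖ₑ ^ (2 * q) ∂μ).toReal, by positivity, fun x hx i => ?_⟩
    rw [ENNReal.ofReal_add zero_le_one ENNReal.toReal_nonneg, ENNReal.ofReal_toReal hK.ne]
    calc ∫⁻ s, ENNReal.ofReal (|grad f x s i| ^ q) ∂μ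
        ≤ ∫⁻ s, (1 + ‖grad f x s‖ₑ ^ (2 * q)) ∂μ := by
          refine lintegral_mono fun s => ?_
          rw [← ofReal_norm, ENNReal.ofReal_rpow_of_nonneg (norm_nonneg _) (by linarith),
            ← ENNReal.ofReal_one, ← ENNReal.ofReal_add zero_le_one (by positivity)]
          refine ENNReal.ofReal_le_ofReal ?_
          have h1 : |grad f x s i| ^ q ≤ ‖grad f x s‖ ^ q :=
            Real.rpow_le_rpow (abs_nonneg _) (PiLp.norm_apply_le (grad f x s) i) (by linarith)
          have h2 : ‖grad f x s‖ ^ (2 * q) = (‖grad f x s‖ ^ q) ^ 2 := by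
            rw [← Real.rpow_two, ← Real.rpow_mul (norm_nonneg _), mul_comm]
          rw [h2]
          nlinarith [sq_nonneg (‖grad f x s‖ ^ q - 1),
            Real.rpow_nonneg (norm_nonneg (grad f x s)) q]
      _ = 1 + ∫⁻ s, ‖grad f x s‖ₑ ^ (2 * q) ∂μ := by
          rw [lintegral_add_left measurable_const]; simp
      _ ≤ _ := by
          rw [ENNReal.ofReal_one]
          gcongr
          exact le_iSup₂_of_le (f := fun x _ => ∫⁻ s, ‖grad f x s‖ₑ ^ (2 * q) ∂μ) x
            (by simpa using hx) le_rfl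
  · refine Or.inr ⟨fun R => ?_, hs⟩
    obtain ⟨σ, hσ, h⟩ := hK _ (isCompact_closedBall (0 : Vec d) R)
    refine ⟨σ, hσ, fun x hx u => ?_⟩
    rw [← hf.gradient_objective x]
    exact (h x (by simpa using hx) u).1

/-- The coordinates of ∇f^{⊙2} are at most ‖∇f‖², so their moment of order q is bounded by the
moment of ∇f of order 2q. -/
lemma noiseCondition_sq_grad
    (h : MomentCondition μ f γ ∨ SubGaussianCondition μ f γ) :
    NoiseCondition μ (fun x s => sq (grad f x s)) fun n => γ (n + 1) := by
  rcases h with ⟨q, hq, hK, hs⟩ | ⟨hK, hs⟩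
  · refine Or.inl ⟨q, hq, fun R => ?_, hs⟩
    have hK := hK _ (isCompact_closedBall (0 : Vec d) R)
    refine ⟨(⨆ x ∈ Metric.closedBall (0 : Vec d) R,
      ∫⁻ s, ‖grad f x s‖ₑ ^ (2 * q) ∂μ).toReal, by positivity, fun x hx i => ?_⟩
    rw [ENNReal.ofReal_toReal hK.ne]
    refine le_trans (lintegral_mono fun s => ?_)
      (le_iSup₂_of_le (f := fun x _ => ∫⁻ s, ‖grad f x s‖ₑ ^ (2 * q) ∂μ) x
            (by simpa using hx) le_rfl)
    rw [← ofReal_norm, ENNReal.ofReal_rpow_of_nonneg (norm_nonneg _) (by linarith)]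
    refine ENNReal.ofReal_le_ofReal ?_
    rw [Real.rpow_mul (norm_nonneg _), Real.rpow_two]
    exact Real.rpow_le_rpow (abs_nonneg _) (abs_sq_apply_le _ i) (by linarith)
  · refine Or.inr ⟨fun R => ?_, hs⟩
    obtain ⟨σ, hσ, h⟩ := hK _ (isCompact_closedBall (0 : Vec d) R)
    exact ⟨σ, hσ, fun x hx u => (h x (by simpa using hx) u).2⟩

end Noise

/-! ### Adaptedness of the iterates. -/

section Iterates

variable {d : ℕ} {Ξ Ω : Type*} [MeasurableSpace Ξ] {μ : Measure Ξ} {f : Vec d → Ξ → ℝ}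

lemma measurable_quot (ε : ℝ) : Measurable fun a : Vec d × Vec d => quot ε a.1 a.2 := by
  unfold quot
  refine (WithLp.measurable_toLp 2 _).comp (measurable_pi_lambda _ fun i => ?_)
  exact Measurable.div (by fun_prop) (Measurable.sqrt (by fun_prop))

lemma RegularModel.measurable_step (hf : RegularModel μ f) (ε γ h r p q : ℝ) :
    Measurable fun a : Ξ × State d => step f ε γ h r p q a.1 a.2 := by
  have hg : Measurable fun a : Ξ × State d => grad f a.2.2.2 a.1 :=
    hf.measurable_grad.comp (measurable_snd.snd.snd.prodMk measurable_fst)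
  have hsq : Measurable fun a : Ξ × State d => sq (grad f a.2.2.2 a.1) := measurable_sq.comp hg
  have hv : Measurable fun a : Ξ × State d =>
      (1 - γ * q) • a.2.1 + (γ * p) • sq (grad f a.2.2.2 a.1) := by fun_prop
  have hm : Measurable fun a : Ξ × State d =>
      (1 - γ * r) • a.2.2.1 + (γ * h) • grad f a.2.2.2 a.1 := by fun_prop
  have hquot : Measurable fun a : Ξ × State d =>
      quot ε ((1 - γ * r) • a.2.2.1 + (γ * h) • grad f a.2.2.2 a.1)
        ((1 - γ * q) • a.2.1 + (γ * p) • sq (grad f a.2.2.2 a.1)) :=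
    (measurable_quot ε).comp (hm.prodMk hv)
  have hx : Measurable fun a : Ξ × State d => a.2.2.2 -
      γ • quot ε ((1 - γ * r) • a.2.2.1 + (γ * h) • grad f a.2.2.2 a.1)
        ((1 - γ * q) • a.2.1 + (γ * p) • sq (grad f a.2.2.2 a.1)) := by fun_prop
  unfold step
  exact hv.prodMk (hm.prodMk hx)

/-- In the shifted numbering, z_n depends only on samples of index less than n, and the sample used
to form z_{n+1} has index exactly n. -/
lemma RegularModel.measurable_iterate (hf : RegularModel μ f) (ε : ℝ) (γ h r p q : ℕ → ℝ)
    (ξ : ℕ → Ω → Ξ) (z0 : State d) (n : ℕ) :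
    Measurable[past (fun n => ξ (n + 1)) n]
      fun ω => iterate f ε γ h r p q (fun k => ξ k ω) z0 n := by
  induction n with
  | zero => exact measurable_const
  | succ n ih =>
    exact (hf.measurable_step _ _ _ _ _ _).comp
      ((measurable_past (fun n => ξ (n + 1)) (Nat.lt_succ_self n)).prodMk
        (ih.mono (past_mono _ (Nat.le_succ n)) le_rfl))

end Iterates

/-! ### Sequences that decrease a Lyapunov function up to o(Γ). -/

section Descent

open Asymptotics

lemma dist_image_tendsto_zero {E E' : Type*} [PseudoMetricSpace E] [PseudoMetricSpace E']
    {K : Set E} (hK : IsCompact K) {g : E → E'} (hg : ContinuousOn g K) {u w : ℕ → E}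
    (hu : ∀ᶠ n in atTop, u n ∈ K) (hw : ∀ᶠ n in atTop, w n ∈ K)
    (h : Tendsto (fun n => dist (u n) (w n)) atTop (𝓝 0)) :
    Tendsto (fun n => dist (g (u n)) (g (w n))) atTop (𝓝 0) := by
  have huc := Metric.uniformContinuousOn_iff.1 (hK.uniformContinuousOn_of_continuous hg)
  rw [Metric.tendsto_nhds]
  intro δ hδ
  obtain ⟨η, hη, H⟩ := huc δ hδ
  filter_upwards [hu, hw, h.eventually_lt_const hη] with n h1 h2 h3
  simpa using H _ h1 _ h2 h3

/-- The mean value inequality on the segment between consecutive points, whose length is O(Γ),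
combined with uniform continuity of the derivative on the compact set. No second derivative is
needed. -/
lemma isLittleO_sub_fderiv {E : Type*} [NormedAddCommGroup E] [NormedSpace ℝ E] {K : Set E}
    (hK : IsCompact K) (hconv : Convex ℝ K) {g : E → ℝ} {g' : E → E →L[ℝ] ℝ}
    (hg : ∀ y ∈ K, HasFDerivAt g (g' y) y) (hg' : ContinuousOn g' K) {Γ : ℕ → ℝ}
    (hΓ : Tendsto Γ atTop (𝓝 0)) {y : ℕ → E} (hy : ∀ᶠ n in atTop, y n ∈ K) {B : ℝ}
    (hB : ∀ᶠ n in atTop, ‖y (n + 1) - y n‖ ≤ B * Γ n) :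
    (fun n => g (y (n + 1)) - g (y n) - g' (y n) (y (n + 1) - y n)) =o[atTop] Γ := by
  have huc := Metric.uniformContinuousOn_iff.1 (hK.uniformContinuousOn_of_continuous hg')
  have hBΓ : Tendsto (fun n => B * Γ n) atTop (𝓝 0) := by simpa using hΓ.const_mul B
  rw [isLittleO_iff]
  intro δ hδ
  obtain ⟨η, hη, H⟩ := huc (δ / (|B| + 1)) (by positivity)
  filter_upwards [hy, (tendsto_add_atTop_nat 1).eventually hy, hB,
    hBΓ.eventually_lt_const hη] with n h1 h2 h3 h4
  have hseg : segment ℝ (y n) (y (n + 1)) ⊆ K := hconv.segment_subset h1 h2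
  have key := (convex_segment (y n) (y (n + 1))).norm_image_sub_le_of_norm_hasFDerivWithin_le'
    (f := g) (f' := g') (φ := g' (y n)) (C := δ / (|B| + 1))
    (fun w hw => (hg w (hseg hw)).hasFDerivWithinAt) (fun w hw => ?_)
    (left_mem_segment ℝ _ _) (right_mem_segment ℝ _ _)
  · refine key.trans ?_
    have h5 : B * Γ n ≤ |B| * ‖Γ n‖ := by
      rw [Real.norm_eq_abs, ← abs_mul]; exact le_abs_self _
    calc δ / (|B| + 1) * ‖y (n + 1) - y n‖ ≤ δ / (|B| + 1) * ((|B| + 1) * ‖Γ n‖) := by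
          gcongr
          nlinarith [norm_nonneg (Γ n)]
      _ = δ * ‖Γ n‖ := by field_simp
  · rw [← dist_eq_norm]
    refine (H _ (hseg hw) _ h1 ?_).le
    rw [dist_eq_norm]
    exact (norm_sub_le_of_mem_segment hw).trans_lt (h3.trans_lt h4)

lemma isLittleO_mul_of_tendsto_zero {Γ u : ℕ → ℝ} (hu : Tendsto u atTop (𝓝 0)) :
    (fun n => Γ n * u n) =o[atTop] Γ := by
  simpa using (isBigO_refl Γ atTop).mul_isLittleO ((isLittleO_one_iff ℝ).2 hu)

/-- First-order expansion of a continuously differentiable function along a perturbed recursion. -/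
lemma isLittleO_sub_of_recursion {E : Type*} [NormedAddCommGroup E] [NormedSpace ℝ E] {K : Set E}
    (hK : IsCompact K) (hconv : Convex ℝ K) {g : E → ℝ} {g' : E → E →L[ℝ] ℝ}
    (hg : ∀ y ∈ K, HasFDerivAt g (g' y) y) (hg' : ContinuousOn g' K) {Γ : ℕ → ℝ}
    (hΓ : ∀ n, 0 < Γ n) (hΓ0 : Tendsto Γ atTop (𝓝 0)) {y b e : ℕ → E}
    (hy : ∀ᶠ n in atTop, y n ∈ K) (hrec : ∀ n, y (n + 1) = y n + Γ n • (b n + e n)) {B : ℝ}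
    (hb : ∀ᶠ n in atTop, ‖b n‖ ≤ B) (he : Tendsto e atTop (𝓝 0)) :
    (fun n => g (y (n + 1)) - g (y n) - Γ n * g' (y n) (b n)) =o[atTop] Γ := by
  have he' : Tendsto (fun n => ‖e n‖) atTop (𝓝 0) := tendsto_zero_iff_norm_tendsto_zero.1 he
  obtain ⟨C, hC⟩ := hK.exists_bound_of_continuousOn hg'
  have h1 : (fun n => g (y (n + 1)) - g (y n) - g' (y n) (y (n + 1) - y n)) =o[atTop] Γ := by
    refine isLittleO_sub_fderiv hK hconv hg hg' hΓ0 hy (B := B + 1) ?_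
    filter_upwards [hb, he'.eventually_le_const one_pos] with n h1 h2
    rw [hrec, add_sub_cancel_left, norm_smul, Real.norm_of_nonneg (hΓ n).le, mul_comm]
    have := hΓ n
    gcongr
    exact (norm_add_le _ _).trans (add_le_add h1 h2)
  have h2 : Tendsto (fun n => g' (y n) (e n)) atTop (𝓝 0) := by
    refine squeeze_zero_norm' (a := fun n => C * ‖e n‖) ?_ (by simpa using he'.const_mul C)
    filter_upwards [hy] with n hn
    exact (g' (y n)).le_of_opNorm_le (hC _ hn) _
  refine (h1.add (isLittleO_mul_of_tendsto_zero h2)).congr_left fun n => ?_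
  simp only [hrec, add_sub_cancel_left, map_smul, map_add, smul_eq_mul]
  ring

lemma exists_Icc_disjoint_of_interior_eq_empty {C : Set ℝ} (hC : IsClosed C)
    (hint : interior C = ∅) {a b : ℝ} (hab : a < b) :
    ∃ a' b', a < a' ∧ a' < b' ∧ b' < b ∧ Disjoint (Icc a' b') C := by
  have h1 : ((Ioo a b) ∩ Cᶜ).Nonempty := by
    by_contra h
    rw [not_nonempty_iff_eq_empty, ← sdiff_eq, sdiff_eq_empty] at h
    have h2 := interior_maximal h isOpen_Ioo
    rw [hint] at h2
    exact (nonempty_Ioo.2 hab).not_subset_empty h2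
  obtain ⟨t, ht, htC⟩ := h1
  obtain ⟨η, hη, hball⟩ := Metric.isOpen_iff.1 (isOpen_Ioo.inter hC.isOpen_compl) t ⟨ht, htC⟩
  have hsub : ∀ s ∈ Icc (t - η / 2) (t + η / 2), s ∈ Ioo a b ∩ Cᶜ := by
    intro s hs
    refine hball ?_
    rw [Metric.mem_ball, Real.dist_eq, abs_lt]
    constructor <;> linarith [hs.1, hs.2]
  refine ⟨t - η / 2, t + η / 2, (hsub _ ⟨le_rfl, by linarith⟩).1.1, by linarith,
    (hsub _ ⟨by linarith, le_rfl⟩).1.2, ?_⟩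
  exact disjoint_left.2 fun s hs => (hsub s hs).2

section LyapunovSequence

variable {E : Type*} [MetricSpace E] {K : Set E} {W Φ : E → ℝ} {Γ e : ℕ → ℝ} {y : ℕ → E}
  {c : ℝ}

/-- Along a sequence with the descent property, the Lyapunov function converges as soon as its
critical values have empty interior. -/
lemma exists_tendsto_lyapunov (hK : IsCompact K) (hW : ContinuousOn W K)
    (hΦ : ContinuousOn Φ K) (hΦ0 : ∀ u ∈ K, 0 ≤ Φ u) (hΓ : ∀ n, 0 < Γ n)
    (hΓ0 : Tendsto Γ atTop (𝓝 0)) (hy : ∀ᶠ n in atTop, y n ∈ K) (hc : 0 < c)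
    (he : e =o[atTop] Γ)
    (hdesc : ∀ᶠ n in atTop, W (y (n + 1)) - W (y n) ≤ -(c * Γ n * Φ (y n)) + e n)
    (hcrit : interior (W '' {u ∈ K | Φ u = 0}) = ∅) :
    ∃ w, Tendsto (fun n => W (y n)) atTop (𝓝 w) := by
  obtain ⟨M, hM⟩ := hK.exists_bound_of_continuousOn hW
  have hZ : IsCompact {u ∈ K | Φ u = 0} :=
    hK.of_isClosed_subset (hΦ.preimage_isClosed_of_isClosed hK.isClosed isClosed_singleton)
      (sep_subset _ _)
  have hclosed : IsClosed (W '' {u ∈ K | Φ u = 0}) :=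
    (hZ.image_of_continuousOn (hW.mono (sep_subset _ _))).isClosed
  refine tendsto_of_no_upcrossings dense_univ ?_ ?_ ?_
  · rintro a - b - hab ⟨hfa, hfb⟩
    obtain ⟨a', b', haa, hab', hbb, hdisj⟩ :=
      exists_Icc_disjoint_of_interior_eq_empty hclosed hcrit hab
    obtain ⟨φ₀, hφ₀, hpos⟩ : ∃ φ₀ > 0, ∀ u ∈ K, W u ∈ Icc a' b' → φ₀ ≤ Φ u := by
      have hcomp : IsCompact (K ∩ W ⁻¹' Icc a' b') :=
        hK.of_isClosed_subset (hW.preimage_isClosed_of_isClosed hK.isClosed isClosed_Icc)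
          inter_subset_left
      rcases (K ∩ W ⁻¹' Icc a' b').eq_empty_or_nonempty with hemp | hne
      · refine ⟨1, one_pos, fun u hu hWu => ?_⟩
        exact absurd (hemp ▸ (⟨hu, hWu⟩ : u ∈ K ∩ W ⁻¹' Icc a' b')) (notMem_empty u)
      · obtain ⟨u₀, hu₀, hmin⟩ := hcomp.exists_isMinOn hne (hΦ.mono inter_subset_left)
        refine ⟨Φ u₀, lt_of_le_of_ne (hΦ0 u₀ hu₀.1) fun h => ?_, fun u hu hWu => hmin ⟨hu, hWu⟩⟩
        exact disjoint_left.1 hdisj hu₀.2 ⟨u₀, ⟨hu₀.1, h.symm⟩, rfl⟩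
    have he0 : Tendsto e atTop (𝓝 0) := he.trans_tendsto hΓ0
    -- The level b' is a barrier from below. From below a' the step is too short to clear [a', b'];
    -- inside [a', b') the dissipation c Γ φ₀ absorbs the error.
    have hev : ∀ᶠ n in atTop, W (y n) < b' → W (y (n + 1)) < b' := by
      filter_upwards [hy, hdesc, he.def (show 0 < c * φ₀ by positivity),
        he0.eventually_lt_const (sub_pos.2 hab')] with n hyn hd h1 h2 hlt
      have hg := hΓ n
      rcases lt_or_ge (W (y n)) a' with h | h
      · have : 0 ≤ c * Γ n * Φ (y n) := mul_nonneg (by positivity) (hΦ0 _ hyn)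
        linarith
      · have h3 := hpos _ hyn ⟨h, hlt.le⟩
        have h4 : c * Γ n * φ₀ ≤ c * Γ n * Φ (y n) := by gcongr
        rw [Real.norm_eq_abs, Real.norm_of_nonneg hg.le] at h1
        have := le_abs_self (e n)
        linarith
    obtain ⟨N, hN⟩ := eventually_atTop.1 hev
    obtain ⟨n₁, hn₁, hlt⟩ := frequently_atTop.1 hfa N
    have hall : ∀ k ≥ n₁, W (y k) < b' := by
      intro k hk
      induction k, hk using Nat.le_induction with
      | base => linarith
      | succ k hk ih => exact hN k (by omega) ih
    obtain ⟨n₂, hn₂, hgt⟩ := frequently_atTop.1 hfb n₁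
    linarith [hall n₂ hn₂]
  · exact ⟨M, eventually_map.2 (hy.mono fun n hn => (le_abs_self _).trans (hM _ hn))⟩
  · exact ⟨-M, eventually_map.2 (hy.mono fun n hn => (abs_le.1 (hM _ hn)).1)⟩

/-- If Φ(y_n) ≥ 2φ₀, bounded speed and uniform continuity keep Φ ≥ φ₀ over a Γ-time at least t.
During it W drops by at least c φ₀ t / 2, which is impossible once W stays within c φ₀ t / 8 of its
limit. -/
lemma tendsto_zero_of_lyapunov (hK : IsCompact K) (hW : ContinuousOn W K)
    (hΦ : ContinuousOn Φ K) (hΦ0 : ∀ u ∈ K, 0 ≤ Φ u) (hΓ : ∀ n, 0 < Γ n)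
    (hΓ0 : Tendsto Γ atTop (𝓝 0))
    (hdiv : Tendsto (fun n => ∑ i ∈ Finset.range n, Γ i) atTop atTop)
    (hy : ∀ᶠ n in atTop, y n ∈ K) {B : ℝ} (hB0 : 0 ≤ B)
    (hB : ∀ᶠ n in atTop, dist (y (n + 1)) (y n) ≤ B * Γ n)
    (hc : 0 < c) (he : e =o[atTop] Γ)
    (hdesc : ∀ᶠ n in atTop, W (y (n + 1)) - W (y n) ≤ -(c * Γ n * Φ (y n)) + e n)
    (hcrit : interior (W '' {u ∈ K | Φ u = 0}) = ∅) :
    Tendsto (fun n => Φ (y n)) atTop (𝓝 0) := by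
  obtain ⟨w, hw⟩ := exists_tendsto_lyapunov hK hW hΦ hΦ0 hΓ hΓ0 hy hc he hdesc hcrit
  have huc := Metric.uniformContinuousOn_iff.1 (hK.uniformContinuousOn_of_continuous hΦ)
  have key : ∀ φ₀ > 0, ∀ᶠ n in atTop, Φ (y n) < 2 * φ₀ := by
    intro φ₀ hφ₀
    obtain ⟨η, hη, H⟩ := huc φ₀ hφ₀
    -- Over a Γ-time 2t the sequence travels at most 2tB ≤ η / 2.
    set t : ℝ := η / (4 * (B + 1)) with ht
    have ht0 : 0 < t := by positivity
    obtain ⟨N, hN⟩ := eventually_atTop.1 (((hy.and hB).and hdesc).and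
      ((he.def (show 0 < c * φ₀ / 2 by positivity)).and
        ((hΓ0.eventually_le_const ht0).and
          (hw.eventually (Metric.ball_mem_nhds w (show 0 < c * φ₀ * t / 8 by positivity))))))
    refine eventually_atTop.2 ⟨N, fun n hn => ?_⟩
    by_contra hcon
    rw [not_lt] at hcon
    obtain ⟨l, hl1, hl2⟩ := exists_sum_range_mem_Icc ht0.le
      (fun k hk => (hN k (hn.trans hk)).2.2.1) hdiv
    have hdist : ∀ j, dist (y (n + j)) (y n) ≤ B * ∑ i ∈ Finset.range j, Γ (n + i) := by
      intro j
      induction j with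
      | zero => simp
      | succ j ih =>
        rw [Finset.sum_range_succ, mul_add]
        have h1 := (hN (n + j) (by omega)).1.1.2
        have h2 := dist_triangle (y (n + j + 1)) (y (n + j)) (y n)
        rw [← add_assoc]
        linarith
    have hlow : ∀ j ≤ l, φ₀ ≤ Φ (y (n + j)) := by
      intro j hj
      have h1 : ∑ i ∈ Finset.range j, Γ (n + i) ≤ 2 * t :=
        (Finset.sum_le_sum_of_subset_of_nonneg (Finset.range_mono hj)
          fun _ _ _ => (hΓ _).le).trans hl2
      have h2 : dist (y (n + j)) (y n) < η := by
        calc dist (y (n + j)) (y n) ≤ B * ∑ i ∈ Finset.range j, Γ (n + i) := hdist j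
          _ ≤ B * (2 * t) := by gcongr
          _ ≤ (B + 1) * (2 * t) := by gcongr; linarith
          _ = η / 2 := by rw [ht]; field_simp; norm_num
          _ < η := by linarith
      have h3 := H _ (hN (n + j) (by omega)).1.1.1 _ (hN n hn).1.1.1 h2
      rw [Real.dist_eq, abs_lt] at h3
      linarith [h3.1]
    have hdec : ∀ j ≤ l, W (y (n + j)) ≤ W (y n) -
        c * φ₀ / 2 * ∑ i ∈ Finset.range j, Γ (n + i) := by
      intro j
      induction j with
      | zero => simp
      | succ j ih =>
        intro hj
        have h1 := ih (by omega)
        have h2 := (hN (n + j) (by omega)).1.2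
        have h3 := (hN (n + j) (by omega)).2.1
        have hg := hΓ (n + j)
        rw [Real.norm_eq_abs, Real.norm_of_nonneg hg.le] at h3
        have h4 : c * Γ (n + j) * φ₀ ≤ c * Γ (n + j) * Φ (y (n + j)) := by
          have := hlow j (by omega)
          gcongr
        have h5 := le_abs_self (e (n + j))
        rw [Finset.sum_range_succ, ← add_assoc]
        linarith
    have h1 := hdec l le_rfl
    have h2 := (hN n hn).2.2.2
    have h3 := (hN (n + l) (by omega)).2.2.2
    change dist _ _ < _ at h2 h3
    rw [Real.dist_eq, abs_lt] at h2 h3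
    have h4 : c * φ₀ / 2 * t ≤ c * φ₀ / 2 * ∑ i ∈ Finset.range l, Γ (n + i) := by gcongr
    have : 0 < c * φ₀ * t := by positivity
    linarith [h2.2, h3.1]
  rw [Metric.tendsto_nhds]
  intro δ hδ
  filter_upwards [key (δ / 2) (by positivity), hy] with n hn hyn
  rw [Real.dist_eq, sub_zero, abs_of_nonneg (hΦ0 _ hyn)]
  linarith

end LyapunovSequence

/-- Once e < qδ, the level δ is preserved, since (1 - qΓ) δ + Γ q δ = δ, while the excess over it
decays like exp(-q ∑ Γ). -/
lemma tendsto_zero_of_contracting {Γ s e : ℕ → ℝ} {q : ℝ} (hq : 0 < q) (hΓ : ∀ n, 0 < Γ n)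
    (hΓ0 : Tendsto Γ atTop (𝓝 0))
    (hdiv : Tendsto (fun n => ∑ i ∈ Finset.range n, Γ i) atTop atTop) (hs : ∀ n, 0 ≤ s n)
    (he : Tendsto e atTop (𝓝 0))
    (hrec : ∀ᶠ n in atTop, s (n + 1) ≤ (1 - q * Γ n) * s n + Γ n * e n) :
    Tendsto s atTop (𝓝 0) := by
  rw [Metric.tendsto_nhds]
  intro δ' hδ'
  obtain ⟨δ, hδ, rfl⟩ : ∃ δ > 0, δ' = 2 * δ := ⟨δ' / 2, by positivity, by ring⟩
  obtain ⟨N, hN⟩ := eventually_atTop.1 (hrec.and ((he.eventually_lt_const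
    (show 0 < q * δ by positivity)).and
    (hΓ0.eventually_lt_const (show 0 < 1 / q by positivity))))
  have hdec : ∀ l, s (N + l) ≤
      Real.exp (-(q * ∑ i ∈ Finset.range l, Γ (N + i))) * s N + δ := by
    intro l
    induction l with
    | zero => simp; positivity
    | succ l ih =>
      obtain ⟨h1, h2, h3⟩ := hN (N + l) (by omega)
      have hg := hΓ (N + l)
      set g := Γ (N + l)
      have hqg : 0 ≤ 1 - q * g := by
        rw [lt_div_iff₀ hq] at h3
        linarith
      rw [Finset.sum_range_succ, mul_add, neg_add, Real.exp_add, ← add_assoc]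
      set a := Real.exp (-(q * ∑ i ∈ Finset.range l, Γ (N + i)))
      have hexp : 1 - q * g ≤ Real.exp (-(q * g)) := by linarith [Real.add_one_le_exp (-(q * g))]
      have ha : 0 ≤ a * s N := mul_nonneg (Real.exp_pos _).le (hs N)
      calc s (N + l + 1) ≤ (1 - q * g) * s (N + l) + g * e (N + l) := h1
        _ ≤ (1 - q * g) * (a * s N + δ) + g * (q * δ) := by gcongr
        _ = (1 - q * g) * (a * s N) + δ := by ring
        _ ≤ Real.exp (-(q * g)) * (a * s N) + δ := by gcongr
        _ = a * Real.exp (-(q * g)) * s N + δ := by ring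
  have hlim : Tendsto (fun l => Real.exp (-(q * ∑ i ∈ Finset.range l, Γ (N + i))) * s N) atTop
      (𝓝 0) := by
    have h1 := (tendsto_sum_range_add hdiv N).const_mul_atTop hq
    simpa using (Real.tendsto_exp_neg_atTop_nhds_zero.comp h1).mul_const (s N)
  obtain ⟨L, hL⟩ := eventually_atTop.1 (hlim.eventually_lt_const hδ)
  refine eventually_atTop.2 ⟨N + L, fun n hn => ?_⟩
  obtain ⟨l, rfl⟩ : ∃ l, n = N + l := ⟨n - N, by omega⟩
  rw [Real.dist_eq, sub_zero, abs_of_nonneg (hs _)]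
  linarith [hdec l, hL l (by omega)]

end Descent

/-! ### The perturbed Euler scheme and its Lyapunov function. -/

section System

open Asymptotics

/-- The function `m² / (2 √(v + ε))` of `(v, m)`. -/
def kinetic (ε : ℝ) (y : ℝ × ℝ) : ℝ := y.2 ^ 2 / 2 * (Real.sqrt (y.1 + ε))⁻¹

/-- The derivative of `kinetic ε`. -/
def kineticDeriv (ε : ℝ) (y : ℝ × ℝ) : ℝ × ℝ →L[ℝ] ℝ :=
  (y.2 / Real.sqrt (y.1 + ε)) • ContinuousLinearMap.snd ℝ ℝ ℝ -
    (y.2 ^ 2 / (4 * ((y.1 + ε) * Real.sqrt (y.1 + ε)))) • ContinuousLinearMap.fst ℝ ℝ ℝ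

lemma hasFDerivAt_kinetic {ε : ℝ} {y : ℝ × ℝ} (hy : 0 < y.1 + ε) :
    HasFDerivAt (kinetic ε) (kineticDeriv ε y) y := by
  have hs : 0 < Real.sqrt (y.1 + ε) := Real.sqrt_pos.2 hy
  have h1 : HasFDerivAt (fun y : ℝ × ℝ => y.1 + ε) (ContinuousLinearMap.fst ℝ ℝ ℝ) y :=
    hasFDerivAt_fst.add_const ε
  have h2 := (Real.hasDerivAt_sqrt hy.ne').inv hs.ne'
  have h3 := h2.comp_hasFDerivAt y h1
  have h4 : HasFDerivAt (fun y : ℝ × ℝ => y.2 ^ 2 / 2) (y.2 • ContinuousLinearMap.snd ℝ ℝ ℝ) y := by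
    have h5 : HasDerivAt (fun t : ℝ => t ^ 2 / 2) y.2 y.2 := by
      have := (hasDerivAt_pow 2 y.2).div_const 2
      simpa using this
    exact h5.comp_hasFDerivAt y hasFDerivAt_snd
  have h5 := h4.mul h3
  refine h5.congr_fderiv ?_
  have hsq : Real.sqrt (y.1 + ε) ^ 2 = y.1 + ε := Real.sq_sqrt hy.le
  ext
  · simp only [kineticDeriv, ContinuousLinearMap.comp_apply, add_apply, sub_apply, smul_apply,
      ContinuousLinearMap.inl_apply, ContinuousLinearMap.coe_fst', ContinuousLinearMap.coe_snd',
      smul_eq_mul, hsq]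
    field_simp
    ring
  · simp [kineticDeriv]
    ring

lemma continuousOn_kineticDeriv {ε : ℝ} {K : Set (ℝ × ℝ)} (hK : ∀ y ∈ K, 0 < y.1 + ε) :
    ContinuousOn (kineticDeriv ε) K := by
  have hs : ∀ y ∈ K, Real.sqrt (y.1 + ε) ≠ 0 := fun y hy => (Real.sqrt_pos.2 (hK y hy)).ne'
  have h0 : ContinuousOn (fun y : ℝ × ℝ => Real.sqrt (y.1 + ε)) K := by fun_prop
  refine ContinuousOn.sub (ContinuousOn.smul (ContinuousOn.div (by fun_prop) h0 hs)
    continuousOn_const) (ContinuousOn.smul (ContinuousOn.div (f := fun y : ℝ × ℝ => y.2 ^ 2)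
      (g := fun y : ℝ × ℝ => 4 * ((y.1 + ε) * Real.sqrt (y.1 + ε))) (by fun_prop) (by fun_prop) ?_)
    continuousOn_const)
  intro y hy
  have := hK y hy
  have := hs y hy
  positivity

variable {d : ℕ}

/-- The margin -ε/2 is needed because the bound is applied to `v` minus the noise correction, which
may be slightly negative. -/
lemma norm_quot_le {ε : ℝ} (hε : 0 < ε) {m v : Vec d} (hv : ∀ i, -(ε / 2) ≤ v i) :
    ‖quot ε m v‖ ≤ (Real.sqrt (ε / 2))⁻¹ * ‖m‖ := by
  have hs : 0 < Real.sqrt (ε / 2) := Real.sqrt_pos.2 (by positivity)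
  refine le_of_sq_le_sq ?_ (by positivity)
  rw [mul_pow, EuclideanSpace.norm_sq_eq, EuclideanSpace.norm_sq_eq, Finset.mul_sum]
  refine Finset.sum_le_sum fun i _ => ?_
  rw [← mul_pow, quot_apply, norm_div, Real.norm_of_nonneg (Real.sqrt_nonneg _), mul_comm,
    div_eq_mul_inv]
  have h1 : Real.sqrt (ε / 2) ≤ Real.sqrt (v i + ε) := Real.sqrt_le_sqrt (by linarith [hv i])
  gcongr

/-- The dissipation inequality behind the Lyapunov function, in one coordinate. -/
lemma kineticDeriv_le {ε v m g S hI rI pI qI : ℝ} (hε : 0 < ε) (hv : 0 < v + ε) (hS : 0 ≤ S)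
    (hp : 0 ≤ pI) (hq : 0 ≤ qI) :
    kineticDeriv ε (v, m) (pI * S - qI * v, hI * g - rI * m) ≤
      hI * (g * (m / Real.sqrt (v + ε))) - (rI - qI / 4) * (m ^ 2 / Real.sqrt (v + ε)) := by
  have hs : 0 < Real.sqrt (v + ε) := Real.sqrt_pos.2 hv
  simp only [kineticDeriv, sub_apply, smul_apply,
    ContinuousLinearMap.coe_fst', ContinuousLinearMap.coe_snd', smul_eq_mul]
  -- The origin of the constant 1/4: the derivative in v weighs m² / (4 (v + ε)^{3/2}), and -v' ≤ q
  -- (v + ε).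
  have h1 : -(m ^ 2 / (4 * ((v + ε) * Real.sqrt (v + ε))) * (pI * S - qI * v)) ≤
      qI / 4 * (m ^ 2 / Real.sqrt (v + ε)) := by
    have h2 : qI / 4 * (m ^ 2 / Real.sqrt (v + ε)) =
        m ^ 2 / (4 * ((v + ε) * Real.sqrt (v + ε))) * (qI * (v + ε)) := by
      field_simp
    rw [h2, ← mul_neg]
    gcongr
    have : 0 ≤ pI * S := by positivity
    have : 0 ≤ qI * ε := by positivity
    linarith
  have h3 : m / Real.sqrt (v + ε) * (hI * g - rI * m) =
      hI * (g * (m / Real.sqrt (v + ε))) - rI * (m ^ 2 / Real.sqrt (v + ε)) := by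
    field_simp
  linarith

/-- Bounded sequences following, up to vanishing errors, the Euler scheme of the limiting
differential equation. -/
structure PerturbedSystem (F : Vec d → ℝ) (g S : Vec d → Vec d) (ε hI rI pI qI R : ℝ)
    (Γ : ℕ → ℝ) (V M x eV eM eX : ℕ → Vec d) : Prop where
  hasGradientAt : ∀ u, HasGradientAt F (g u) u
  g_lip : LocallyLipschitz g
  S_lip : LocallyLipschitz S
  S_nonneg : ∀ u i, 0 ≤ S u i
  ε_pos : 0 < ε
  hI_pos : 0 < hI
  pI_nonneg : 0 ≤ pI
  qI_pos : 0 < qI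
  rI_gt : qI / 4 < rI
  Γ_pos : ∀ n, 0 < Γ n
  Γ_zero : Tendsto Γ atTop (𝓝 0)
  Γ_div : Tendsto (fun n => ∑ i ∈ Finset.range n, Γ i) atTop atTop
  V_rec : ∀ n, V (n + 1) = V n + Γ n • ((pI • S (x n) - qI • V n) + eV n)
  M_rec : ∀ n, M (n + 1) = M n + Γ n • ((hI • g (x n) - rI • M n) + eM n)
  x_rec : ∀ n, x (n + 1) = x n + Γ n • (-quot ε (M n) (V n) + eX n)
  eV_zero : Tendsto eV atTop (𝓝 0)
  eM_zero : Tendsto eM atTop (𝓝 0)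
  eX_zero : Tendsto eX atTop (𝓝 0)
  V_le : ∀ n, ‖V n‖ ≤ R
  M_le : ∀ n, ‖M n‖ ≤ R
  x_le : ∀ n, ‖x n‖ ≤ R
  V_ge : ∀ᶠ n in atTop, ∀ i, -(ε / 2) ≤ V n i

namespace PerturbedSystem

variable {F : Vec d → ℝ} {g S : Vec d → Vec d} {ε hI rI pI qI R : ℝ}
  {Γ : ℕ → ℝ} {V M x eV eM eX : ℕ → Vec d}

/-- The compact region in which the sequences eventually live. -/
def region (d : ℕ) (ε R : ℝ) : Set (State d) :=
  Metric.closedBall 0 R ∩ {y | ∀ i, -(ε / 2) ≤ y.1 i}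

lemma isCompact_region : IsCompact (region d ε R) := by
  refine (isCompact_closedBall _ _).inter_right ?_
  simp only [ofPred_forall]
  exact isClosed_iInter fun i => isClosed_le continuous_const (by fun_prop)

/-- The Lyapunov function. -/
def lyapunov (F : Vec d → ℝ) (g : Vec d → Vec d) (ε hI δ : ℝ) (y : State d) : ℝ :=
  hI * F y.2.2 + ∑ i, kinetic ε (y.1 i, y.2.1 i) - δ * inner ℝ (g y.2.2) y.2.1

/-- The dissipation associated with the Lyapunov function. -/
def dissipation (g : Vec d → Vec d) (y : State d) : ℝ := ‖y.2.1‖ ^ 2 + ‖g y.2.2‖ ^ 2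

lemma mem_region
    (H : PerturbedSystem F g S ε hI rI pI qI R Γ V M x eV eM eX) :
    ∀ᶠ n in atTop, (V n, M n, x n) ∈ region d ε R := by
  filter_upwards [H.V_ge] with n hn
  refine ⟨?_, hn⟩
  simp [Prod.norm_def, H.V_le, H.M_le, H.x_le]

lemma continuousOn_lyapunov
    (H : PerturbedSystem F g S ε hI rI pI qI R Γ V M x eV eM eX) (δ : ℝ) :
    ContinuousOn (lyapunov F g ε hI δ) (region d ε R) := by
  have hF : Continuous F := continuous_iff_continuousAt.2 fun u => (H.hasGradientAt u).continuousAt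
  have hg := H.g_lip.continuous
  unfold lyapunov
  refine ContinuousOn.sub (ContinuousOn.add (by fun_prop)
    (continuousOn_finsetSum _ fun i _ => ?_)) (by fun_prop)
  unfold kinetic
  refine ContinuousOn.mul (by fun_prop) (ContinuousOn.inv₀ (by fun_prop) fun y hy => ?_)
  have := hy.2 i
  have := H.ε_pos
  exact (Real.sqrt_pos.2 (by linarith)).ne'

lemma continuous_dissipation
    (H : PerturbedSystem F g S ε hI rI pI qI R Γ V M x eV eM eX) : Continuous (dissipation g) := by
  have hg := H.g_lip.continuous
  unfold dissipation
  fun_prop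

lemma exists_bound
    (H : PerturbedSystem F g S ε hI rI pI qI R Γ V M x eV eM eX)
    {E : Type*} [NormedAddCommGroup E] {T : Vec d → E} (hT : Continuous T) :
    ∃ C : ℝ, 0 ≤ C ∧ ∀ n, ‖T (x n)‖ ≤ C := by
  obtain ⟨C, hC⟩ := (isCompact_closedBall (0 : Vec d) R).exists_bound_of_continuousOn
    hT.continuousOn
  have h : ∀ n, ‖T (x n)‖ ≤ C := fun n => hC _ (by simpa using H.x_le n)
  exact ⟨C, (norm_nonneg _).trans (h 0), h⟩

lemma exists_lipschitz
    (H : PerturbedSystem F g S ε hI rI pI qI R Γ V M x eV eM eX)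
    {T : Vec d → Vec d} (hT : LocallyLipschitz T) :
    ∃ L : ℝ, 0 ≤ L ∧ ∀ n k, ‖T (x n) - T (x k)‖ ≤ L * ‖x n - x k‖ := by
  obtain ⟨L, hL⟩ := LocallyLipschitzOn.exists_lipschitzOnWith_of_compact
    (isCompact_closedBall (0 : Vec d) R) hT.locallyLipschitzOn
  exact ⟨L, L.2, fun n k => hL.norm_sub_le (by simpa using H.x_le n) (by simpa using H.x_le k)⟩

lemma R_nonneg
    (H : PerturbedSystem F g S ε hI rI pI qI R Γ V M x eV eM eX) :
    0 ≤ R := (norm_nonneg _).trans (H.V_le 0)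

lemma exists_drift_bound
    (H : PerturbedSystem F g S ε hI rI pI qI R Γ V M x eV eM eX) :
    ∃ B : ℝ, 0 ≤ B ∧ ∀ᶠ n in atTop, ‖pI • S (x n) - qI • V n‖ ≤ B ∧
    ‖hI • g (x n) - rI • M n‖ ≤ B ∧ ‖-quot ε (M n) (V n)‖ ≤ B := by
  obtain ⟨C₁, hC₁, h1⟩ := H.exists_bound H.S_lip.continuous
  obtain ⟨C₂, hC₂, h2⟩ := H.exists_bound H.g_lip.continuous
  have hR := H.R_nonneg
  refine ⟨|pI| * C₁ + |qI| * R + (|hI| * C₂ + |rI| * R) + (Real.sqrt (ε / 2))⁻¹ * R,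
    by positivity, ?_⟩
  have e1 : 0 ≤ |pI| * C₁ + |qI| * R := by positivity
  have e2 : 0 ≤ |hI| * C₂ + |rI| * R := by positivity
  have e3 : 0 ≤ (Real.sqrt (ε / 2))⁻¹ * R := by positivity
  filter_upwards [H.V_ge] with n hn
  refine ⟨?_, ?_, ?_⟩
  · have : ‖pI • S (x n) - qI • V n‖ ≤ |pI| * C₁ + |qI| * R := by
      refine (norm_sub_le _ _).trans ?_
      rw [norm_smul, norm_smul]
      exact add_le_add (mul_le_mul_of_nonneg_left (h1 n) (abs_nonneg _))
        (mul_le_mul_of_nonneg_left (H.V_le n) (abs_nonneg _))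
    linarith
  · have : ‖hI • g (x n) - rI • M n‖ ≤ |hI| * C₂ + |rI| * R := by
      refine (norm_sub_le _ _).trans ?_
      rw [norm_smul, norm_smul]
      exact add_le_add (mul_le_mul_of_nonneg_left (h2 n) (abs_nonneg _))
        (mul_le_mul_of_nonneg_left (H.M_le n) (abs_nonneg _))
    linarith
  · have : ‖-quot ε (M n) (V n)‖ ≤ (Real.sqrt (ε / 2))⁻¹ * R := by
      rw [norm_neg]
      refine (norm_quot_le H.ε_pos hn).trans ?_
      have := H.M_le n
      gcongr
    linarith

lemma isLittleO_objective
    (H : PerturbedSystem F g S ε hI rI pI qI R Γ V M x eV eM eX) :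
    (fun n => F (x (n + 1)) - F (x n) - Γ n * inner ℝ (g (x n)) (-quot ε (M n) (V n)))
      =o[atTop] Γ := by
  obtain ⟨B, -, hB⟩ := H.exists_drift_bound
  refine isLittleO_sub_of_recursion (isCompact_closedBall (0 : Vec d) R) (convex_closedBall _ _)
    (g := F) (g' := fun u => InnerProductSpace.toDual ℝ (Vec d) (g u))
    (fun u _ => (H.hasGradientAt u).hasFDerivAt)
    ((LinearIsometryEquiv.continuous _).comp H.g_lip.continuous).continuousOn H.Γ_pos H.Γ_zero
    (Eventually.of_forall fun n => by simpa using H.x_le n) H.x_rec (hB.mono fun n h => h.2.2)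
    H.eX_zero

lemma isLittleO_kinetic
    (H : PerturbedSystem F g S ε hI rI pI qI R Γ V M x eV eM eX) (i : Fin d) :
    (fun n => kinetic ε (V (n + 1) i, M (n + 1) i) - kinetic ε (V n i, M n i) -
      Γ n * kineticDeriv ε (V n i, M n i)
        (pI * S (x n) i - qI * V n i, hI * g (x n) i - rI * M n i)) =o[atTop] Γ := by
  obtain ⟨B, -, hB⟩ := H.exists_drift_bound
  have hε := H.ε_pos
  have hK : ∀ y ∈ Icc (-(ε / 2)) R ×ˢ Icc (-R) R, (0 : ℝ) < y.1 + ε := fun y hy => by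
    linarith [hy.1.1]
  have hcoord : ∀ {T : ℕ → Vec d}, Tendsto T atTop (𝓝 0) →
      Tendsto (fun n => T n i) atTop (𝓝 0) := fun hT => by
    exact (EuclideanSpace.proj (𝕜 := ℝ) i : Vec d →L[ℝ] ℝ).continuous.tendsto' 0 0 (map_zero _)
      |>.comp hT
  refine isLittleO_sub_of_recursion (isCompact_Icc.prod isCompact_Icc)
    ((convex_Icc _ _).prod (convex_Icc _ _)) (K := Icc (-(ε / 2)) R ×ˢ Icc (-R) R)
    (g := kinetic ε) (g' := kineticDeriv ε)
    (y := fun n => (V n i, M n i))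
    (b := fun n => (pI * S (x n) i - qI * V n i, hI * g (x n) i - rI * M n i))
    (e := fun n => (eV n i, eM n i))
    (fun y hy => hasFDerivAt_kinetic (hK y hy)) (continuousOn_kineticDeriv hK) H.Γ_pos H.Γ_zero
    ?_ ?_ (B := B) ?_ ?_
  · filter_upwards [H.V_ge] with n hn
    have h1 := (PiLp.norm_apply_le (V n) i).trans (H.V_le n)
    have h2 := (PiLp.norm_apply_le (M n) i).trans (H.M_le n)
    exact ⟨⟨hn i, (abs_le.1 h1).2⟩, abs_le.1 h2⟩
  · intro n
    simp [H.V_rec n, H.M_rec n, mul_add]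
  · filter_upwards [hB] with n hn
    have h1 := (PiLp.norm_apply_le (pI • S (x n) - qI • V n) i).trans hn.1
    have h2 := (PiLp.norm_apply_le (hI • g (x n) - rI • M n) i).trans hn.2.1
    exact max_le (by simpa using h1) (by simpa using h2)
  · exact (hcoord H.eV_zero).prodMk_nhds (hcoord H.eM_zero)

end PerturbedSystem

end System

/-! ### Descent and limits for the perturbed scheme. -/

section SystemLimit

open Asymptotics

variable {d : ℕ}

namespace PerturbedSystem

variable {F : Vec d → ℝ} {g S : Vec d → Vec d} {ε hI rI pI qI R : ℝ}
  {Γ : ℕ → ℝ} {V M x eV eM eX : ℕ → Vec d}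

lemma exists_increment_bound
    (H : PerturbedSystem F g S ε hI rI pI qI R Γ V M x eV eM eX) :
    ∃ B : ℝ, 0 ≤ B ∧ ∀ᶠ n in atTop, ‖V (n + 1) - V n‖ ≤ B * Γ n ∧
      ‖M (n + 1) - M n‖ ≤ B * Γ n ∧ ‖x (n + 1) - x n‖ ≤ B * Γ n := by
  obtain ⟨B, hB0, hB⟩ := H.exists_drift_bound
  have key : ∀ {b e : Vec d} {t : ℝ}, 0 < t → ‖b‖ ≤ B → ‖e‖ ≤ 1 →
      ‖t • (b + e)‖ ≤ (B + 1) * t := by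
    intro b e t ht hb he
    rw [norm_smul, Real.norm_of_nonneg ht.le, mul_comm]
    gcongr
    exact (norm_add_le _ _).trans (add_le_add hb he)
  refine ⟨B + 1, by positivity, ?_⟩
  filter_upwards [hB, (tendsto_zero_iff_norm_tendsto_zero.1 H.eV_zero).eventually_le_const one_pos,
    (tendsto_zero_iff_norm_tendsto_zero.1 H.eM_zero).eventually_le_const one_pos,
    (tendsto_zero_iff_norm_tendsto_zero.1 H.eX_zero).eventually_le_const one_pos] with n hn h1 h2 h3
  refine ⟨?_, ?_, ?_⟩
  · rw [H.V_rec, add_sub_cancel_left]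
    exact key (H.Γ_pos n) hn.1 h1
  · rw [H.M_rec, add_sub_cancel_left]
    exact key (H.Γ_pos n) hn.2.1 h2
  · rw [H.x_rec, add_sub_cancel_left]
    exact key (H.Γ_pos n) hn.2.2 h3

lemma tendsto_increment_M (H : PerturbedSystem F g S ε hI rI pI qI R Γ V M x eV eM eX) :
    Tendsto (fun n => ‖M (n + 1) - M n‖) atTop (𝓝 0) := by
  obtain ⟨B, -, hB⟩ := H.exists_increment_bound
  refine squeeze_zero' (Eventually.of_forall fun n => norm_nonneg _) (hB.mono fun n h => h.2.1) ?_
  simpa using H.Γ_zero.const_mul B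

lemma norm_increment_x_le
    (H : PerturbedSystem F g S ε hI rI pI qI R Γ V M x eV eM eX) :
    ∀ᶠ n in atTop, ‖x (n + 1) - x n‖ ≤ Γ n * ((Real.sqrt (ε / 2))⁻¹ * ‖M n‖ + ‖eX n‖) := by
  filter_upwards [H.V_ge] with n hn
  rw [H.x_rec, add_sub_cancel_left, norm_smul, Real.norm_of_nonneg (H.Γ_pos n).le]
  refine mul_le_mul_of_nonneg_left ((norm_add_le _ _).trans ?_) (H.Γ_pos n).le
  rw [norm_neg]
  exact add_le_add_left (norm_quot_le H.ε_pos hn) _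

/-- The Lyapunov function decreases along the sequences, up to `o(Γ)`. -/
lemma exists_descent (H : PerturbedSystem F g S ε hI rI pI qI R Γ V M x eV eM eX) :
    ∃ δ c : ℝ, 0 < c ∧ ∃ e : ℕ → ℝ, e =o[atTop] Γ ∧ ∀ᶠ n in atTop,
      lyapunov F g ε hI δ (V (n + 1), M (n + 1), x (n + 1)) -
        lyapunov F g ε hI δ (V n, M n, x n) ≤
      -(c * Γ n * dissipation g (V n, M n, x n)) + e n := by
  have hε := H.ε_pos
  have hhI := H.hI_pos
  have hR := H.R_nonneg
  obtain ⟨L, hL0, hL⟩ := H.exists_lipschitz H.g_lip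
  obtain ⟨G, hG0, hG⟩ := H.exists_bound H.g_lip.continuous
  set κ : ℝ := (Real.sqrt (ε / 2))⁻¹ with hκ
  have hκ0 : 0 ≤ κ := by positivity
  set s : ℝ := Real.sqrt (R + ε) with hs
  have hs0 : 0 < s := Real.sqrt_pos.2 (by linarith)
  set c₁ : ℝ := (rI - qI / 4) / s with hc₁
  have hc₁0 : 0 < c₁ := div_pos (by linarith [H.rI_gt]) hs0
  -- The cross term creates multiples of ‖M‖²: L κ from the motion of g(x), and r² / (2h) from
  -- Young's inequality applied to r ⟨g, M⟩. The choice of δ makes them use at most half of the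
  -- damping c₁.
  set D : ℝ := L * κ + rI ^ 2 / (2 * hI) + 1 with hD
  have hD0 : 0 < D := by positivity
  set δ : ℝ := c₁ / (2 * D) with hδ
  have hδ0 : 0 < δ := by positivity
  -- The remaining products: each contains an increment of M or the error eX, so it vanishes in the
  -- limit.
  set u : ℕ → ℝ := fun n =>
    L * (κ * ‖M n‖ * ‖M (n + 1) - M n‖ + ‖eX n‖ * ‖M n‖ + ‖eX n‖ * ‖M (n + 1) - M n‖) with hu
  have heX : Tendsto (fun n => ‖eX n‖) atTop (𝓝 0) :=
    tendsto_zero_iff_norm_tendsto_zero.1 H.eX_zero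
  have heM : Tendsto (fun n => ‖eM n‖) atTop (𝓝 0) :=
    tendsto_zero_iff_norm_tendsto_zero.1 H.eM_zero
  have hu0 : Tendsto u atTop (𝓝 0) := by
    refine squeeze_zero (fun n => by positivity) (g := fun n =>
      L * (κ * R * ‖M (n + 1) - M n‖ + ‖eX n‖ * R + ‖eX n‖ * ‖M (n + 1) - M n‖)) (fun n => ?_) ?_
    · have := H.M_le n
      simp only [hu]
      gcongr
    · have h1 := H.tendsto_increment_M
      have := ((((h1.const_mul (κ * R)).add (heX.mul_const R)).add (heX.mul h1)).const_mul L)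
      simpa using this
  have hi0 : Tendsto (fun n => inner ℝ (g (x n)) (eM n)) atTop (𝓝 0) := by
    refine squeeze_zero_norm (a := fun n => G * ‖eM n‖) (fun n => ?_)
      (by simpa using heM.const_mul G)
    exact (norm_inner_le_norm _ _).trans (mul_le_mul_of_nonneg_right (hG n) (norm_nonneg _))
  have hEA := H.isLittleO_objective
  have hEB := fun i => H.isLittleO_kinetic i
  set EA : ℕ → ℝ := fun n =>
    F (x (n + 1)) - F (x n) - Γ n * inner ℝ (g (x n)) (-quot ε (M n) (V n)) with hEAdef
  set EB : Fin d → ℕ → ℝ := fun i n =>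
    kinetic ε (V (n + 1) i, M (n + 1) i) - kinetic ε (V n i, M n i) -
      Γ n * kineticDeriv ε (V n i, M n i)
        (pI * S (x n) i - qI * V n i, hI * g (x n) i - rI * M n i) with hEBdef
  refine ⟨δ, min (c₁ / 2) (δ * hI / 2), by positivity, fun n => hI * EA n + ∑ i, EB i n -
    δ * (Γ n * inner ℝ (g (x n)) (eM n)) + δ * (Γ n * u n), ?_, ?_⟩
  · have hsum : (fun n => ∑ i, EB i n) =o[atTop] Γ :=
      (IsLittleO.sum (s := Finset.univ) fun i _ => hEB i).congr_left fun n => by simp [EB]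
    exact (((hEA.const_mul_left hI).add hsum).sub
      ((isLittleO_mul_of_tendsto_zero hi0).const_mul_left δ)).add
      ((isLittleO_mul_of_tendsto_zero hu0).const_mul_left δ)
  filter_upwards [H.V_ge, H.norm_increment_x_le] with n hVn hxn
  have hΓ := H.Γ_pos n
  have hkin : ∀ i, kineticDeriv ε (V n i, M n i)
      (pI * S (x n) i - qI * V n i, hI * g (x n) i - rI * M n i) ≤
      hI * (g (x n) i * quot ε (M n) (V n) i) - c₁ * M n i ^ 2 := by
    intro i
    have hvi : 0 < V n i + ε := by linarith [hVn i]
    have h1 := kineticDeriv_le (m := M n i) (g := g (x n) i) (hI := hI) (rI := rI) hε hvi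
      (H.S_nonneg (x n) i) H.pI_nonneg H.qI_pos.le
    have h2 : c₁ * M n i ^ 2 ≤ (rI - qI / 4) * (M n i ^ 2 / Real.sqrt (V n i + ε)) := by
      have h3 : Real.sqrt (V n i + ε) ≤ s := by
        refine Real.sqrt_le_sqrt ?_
        have := (PiLp.norm_apply_le (V n) i).trans (H.V_le n)
        linarith [le_abs_self (V n i), Real.norm_eq_abs (V n i)]
      have h4 : M n i ^ 2 / s ≤ M n i ^ 2 / Real.sqrt (V n i + ε) :=
        div_le_div_of_nonneg_left (sq_nonneg _) (Real.sqrt_pos.2 hvi) h3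
      calc c₁ * M n i ^ 2 = (rI - qI / 4) * (M n i ^ 2 / s) := by rw [hc₁]; ring
        _ ≤ _ := mul_le_mul_of_nonneg_left h4 (by linarith [H.rI_gt])
    rw [quot_apply]
    linarith
  have hinner : inner ℝ (g (x n)) (-quot ε (M n) (V n)) =
      -∑ i, g (x n) i * quot ε (M n) (V n) i := by
    rw [inner_neg_right, PiLp.inner_apply]
    simp [mul_comm]
  have hkinsum : ∑ i, kineticDeriv ε (V n i, M n i)
      (pI * S (x n) i - qI * V n i, hI * g (x n) i - rI * M n i) ≤
      -(hI * inner ℝ (g (x n)) (-quot ε (M n) (V n))) - c₁ * ‖M n‖ ^ 2 := by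
    refine (Finset.sum_le_sum fun i _ => hkin i).trans (le_of_eq ?_)
    rw [hinner, EuclideanSpace.norm_sq_eq, Finset.sum_sub_distrib, ← Finset.mul_sum,
      ← Finset.mul_sum]
    simp
  -- Since g is only locally Lipschitz, ⟨g(x), m⟩ need not be differentiable; its increment is split
  -- by hand, and the motion of g is estimated through that of x.
  have hcross : inner ℝ (g (x (n + 1))) (M (n + 1)) - inner ℝ (g (x n)) (M n) =
      Γ n * (hI * ‖g (x n)‖ ^ 2 - rI * inner ℝ (g (x n)) (M n)) +
      Γ n * inner ℝ (g (x n)) (eM n) + inner ℝ (g (x (n + 1)) - g (x n)) (M (n + 1)) := by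
    have h1 : inner ℝ (g (x (n + 1))) (M (n + 1)) - inner ℝ (g (x n)) (M n) =
        inner ℝ (g (x n)) (M (n + 1) - M n) +
          inner ℝ (g (x (n + 1)) - g (x n)) (M (n + 1)) := by
      rw [inner_sub_right, inner_sub_left]; ring
    rw [h1]
    nth_rewrite 1 [H.M_rec n]
    rw [add_sub_cancel_left, inner_smul_right, inner_add_right, inner_sub_right, inner_smul_right,
      inner_smul_right, real_inner_self_eq_norm_sq]
    ring
  have hlast : -(Γ n * (L * κ * ‖M n‖ ^ 2 + u n)) ≤
      inner ℝ (g (x (n + 1)) - g (x n)) (M (n + 1)) := by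
    have h1 := abs_real_inner_le_norm (g (x (n + 1)) - g (x n)) (M (n + 1))
    have h2 : ‖M (n + 1)‖ ≤ ‖M n‖ + ‖M (n + 1) - M n‖ := by
      calc ‖M (n + 1)‖ = ‖M n + (M (n + 1) - M n)‖ := by congr 1; abel
        _ ≤ _ := norm_add_le _ _
    have h3 : ‖g (x (n + 1)) - g (x n)‖ * ‖M (n + 1)‖ ≤
        (L * (Γ n * (κ * ‖M n‖ + ‖eX n‖))) * (‖M n‖ + ‖M (n + 1) - M n‖) := by
      gcongr
      exact (hL _ _).trans (mul_le_mul_of_nonneg_left hxn hL0)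
    have h4 : (L * (Γ n * (κ * ‖M n‖ + ‖eX n‖))) * (‖M n‖ + ‖M (n + 1) - M n‖) =
        Γ n * (L * κ * ‖M n‖ ^ 2 + u n) := by rw [hu]; ring
    linarith [neg_abs_le (inner ℝ (g (x (n + 1)) - g (x n)) (M (n + 1)))]
  have hyoung : rI * inner ℝ (g (x n)) (M n) ≤
      hI / 2 * ‖g (x n)‖ ^ 2 + rI ^ 2 / (2 * hI) * ‖M n‖ ^ 2 := by
    have h1 := abs_real_inner_le_norm (g (x n)) (M n)
    have h2 : rI * inner ℝ (g (x n)) (M n) ≤ |rI| * (‖g (x n)‖ * ‖M n‖) := by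
      refine (le_abs_self _).trans ?_
      rw [abs_mul]
      gcongr
    have h3 : hI / 2 * ‖g (x n)‖ ^ 2 + rI ^ 2 / (2 * hI) * ‖M n‖ ^ 2 -
        |rI| * (‖g (x n)‖ * ‖M n‖) = (hI * ‖g (x n)‖ - |rI| * ‖M n‖) ^ 2 / (2 * hI) := by
      rw [← sq_abs rI]
      field_simp
      ring
    have h4 : 0 ≤ (hI * ‖g (x n)‖ - |rI| * ‖M n‖) ^ 2 / (2 * hI) := by positivity
    linarith
  have hδD : δ * (L * κ + rI ^ 2 / (2 * hI)) ≤ c₁ / 2 := by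
    calc δ * (L * κ + rI ^ 2 / (2 * hI)) ≤ δ * D := by
          refine mul_le_mul_of_nonneg_left ?_ hδ0.le
          rw [hD]; linarith
      _ = c₁ / 2 := by rw [hδ]; field_simp
  have hrate : -(c₁ * ‖M n‖ ^ 2) - δ * (hI * ‖g (x n)‖ ^ 2 - rI * inner ℝ (g (x n)) (M n)) +
      δ * (L * κ * ‖M n‖ ^ 2) ≤
      -(min (c₁ / 2) (δ * hI / 2) * (‖M n‖ ^ 2 + ‖g (x n)‖ ^ 2)) := by
    have h1 := mul_le_mul_of_nonneg_left hyoung hδ0.le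
    have h2 := mul_le_mul_of_nonneg_right hδD (sq_nonneg ‖M n‖)
    have h3 := mul_le_mul_of_nonneg_right (min_le_left (c₁ / 2) (δ * hI / 2)) (sq_nonneg ‖M n‖)
    have h4 := mul_le_mul_of_nonneg_right (min_le_right (c₁ / 2) (δ * hI / 2))
      (sq_nonneg ‖g (x n)‖)
    linarith
  have hA : F (x (n + 1)) - F (x n) =
      Γ n * inner ℝ (g (x n)) (-quot ε (M n) (V n)) + EA n := by rw [hEAdef]; ring
  have hBsum : ∑ i, kinetic ε (V (n + 1) i, M (n + 1) i) - ∑ i, kinetic ε (V n i, M n i) =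
      Γ n * ∑ i, kineticDeriv ε (V n i, M n i)
        (pI * S (x n) i - qI * V n i, hI * g (x n) i - rI * M n i) + ∑ i, EB i n := by
    rw [← Finset.sum_sub_distrib, Finset.mul_sum, ← Finset.sum_add_distrib]
    refine Finset.sum_congr rfl fun i _ => ?_
    rw [hEBdef]; ring
  have h1 := mul_le_mul_of_nonneg_left hkinsum hΓ.le
  have h2 := mul_le_mul_of_nonneg_left hlast hδ0.le
  have h3 := mul_le_mul_of_nonneg_left hrate hΓ.le
  have h4 : lyapunov F g ε hI δ (V (n + 1), M (n + 1), x (n + 1)) -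
      lyapunov F g ε hI δ (V n, M n, x n) =
      hI * (F (x (n + 1)) - F (x n)) + (∑ i, kinetic ε (V (n + 1) i, M (n + 1) i) -
        ∑ i, kinetic ε (V n i, M n i)) -
      δ * (inner ℝ (g (x (n + 1))) (M (n + 1)) - inner ℝ (g (x n)) (M n)) := by
    simp only [lyapunov]; ring
  rw [h4, hA, hBsum, hcross]
  simp only [dissipation]
  linarith

/-- Zero dissipation means m = 0 and g(x) = 0, where the Lyapunov function reduces to h_∞ F(x)
whatever v is; scaling by h_∞ ≠ 0 is a homeomorphism. -/
lemma interior_critical_values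
    (H : PerturbedSystem F g S ε hI rI pI qI R Γ V M x eV eM eX) (δ : ℝ)
    (hsard : interior (F '' {u | g u = 0}) = ∅) :
    interior (lyapunov F g ε hI δ '' {y ∈ region d ε R | dissipation g y = 0}) = ∅ := by
  have hsub : lyapunov F g ε hI δ '' {y ∈ region d ε R | dissipation g y = 0} ⊆
      Homeomorph.mulLeft₀ hI H.hI_pos.ne' '' (F '' {u | g u = 0}) := by
    rintro _ ⟨y, ⟨-, hy⟩, rfl⟩
    have h1 : ‖y.2.1‖ ^ 2 = 0 ∧ ‖g y.2.2‖ ^ 2 = 0 :=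
      (add_eq_zero_iff_of_nonneg (sq_nonneg _) (sq_nonneg _)).1 hy
    have hM : y.2.1 = 0 := by simpa using h1.1
    have hg : g y.2.2 = 0 := by simpa using h1.2
    refine ⟨F y.2.2, ⟨y.2.2, hg, rfl⟩, ?_⟩
    simp [lyapunov, hM, hg, kinetic]
  refine subset_empty_iff.1 ((interior_mono hsub).trans ?_)
  rw [← Homeomorph.image_interior, hsard, image_empty]

lemma tendsto_dissipation
    (H : PerturbedSystem F g S ε hI rI pI qI R Γ V M x eV eM eX)
    (hsard : interior (F '' {u | g u = 0}) = ∅) :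
    Tendsto M atTop (𝓝 0) ∧ Tendsto (fun n => g (x n)) atTop (𝓝 0) := by
  obtain ⟨δ, c, hc, e, he, hdesc⟩ := H.exists_descent
  obtain ⟨B, hB0, hB⟩ := H.exists_increment_bound
  have key := tendsto_zero_of_lyapunov (y := fun n => (V n, M n, x n)) isCompact_region
    (H.continuousOn_lyapunov δ) H.continuous_dissipation.continuousOn
    (fun y _ => by unfold dissipation; positivity) H.Γ_pos H.Γ_zero H.Γ_div H.mem_region hB0
    (hB.mono fun n h => by
      simp only [dist_eq_norm]
      exact max_le h.1 (max_le h.2.1 h.2.2))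
    hc he hdesc (H.interior_critical_values δ hsard)
  have hroot : Tendsto (fun n => Real.sqrt (dissipation g (V n, M n, x n))) atTop (𝓝 0) := by
    simpa using key.sqrt
  constructor
  · refine squeeze_zero_norm (fun n => Real.le_sqrt_of_sq_le ?_) hroot
    simp only [dissipation]
    linarith [sq_nonneg ‖g (x n)‖]
  · refine squeeze_zero_norm (fun n => Real.le_sqrt_of_sq_le ?_) hroot
    simp only [dissipation]
    linarith [sq_nonneg ‖M n‖]

/-- The difference contracts at rate q_∞, while its target moves by only Γ_n o(1) per step, because
the speed of x is controlled by M and eX, which tend to 0. -/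
lemma tendsto_V_sub
    (H : PerturbedSystem F g S ε hI rI pI qI R Γ V M x eV eM eX)
    (hM : Tendsto M atTop (𝓝 0)) :
    Tendsto (fun n => V n - (pI / qI) • S (x n)) atTop (𝓝 0) := by
  obtain ⟨L, hL0, hL⟩ := H.exists_lipschitz H.S_lip
  have hq := H.qI_pos
  have hp := H.pI_nonneg
  set κ : ℝ := (Real.sqrt (ε / 2))⁻¹
  rw [tendsto_zero_iff_norm_tendsto_zero]
  refine tendsto_zero_of_contracting (q := qI) hq H.Γ_pos H.Γ_zero H.Γ_div
    (fun n => norm_nonneg _)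
    (e := fun n => ‖eV n‖ + pI / qI * (L * (κ * ‖M n‖ + ‖eX n‖))) ?_ ?_
  · have := H.eV_zero.norm.add ((((hM.norm.const_mul κ).add H.eX_zero.norm).const_mul L).const_mul
      (pI / qI))
    simpa using this
  · filter_upwards [H.norm_increment_x_le, H.Γ_zero.eventually_lt_const
      (show 0 < 1 / qI by positivity)] with n hx hΓ1
    have hΓ := H.Γ_pos n
    have hqΓ : 0 ≤ 1 - qI * Γ n := by
      rw [lt_div_iff₀ hq] at hΓ1
      linarith
    have h1 : V (n + 1) - (pI / qI) • S (x (n + 1)) =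
        (1 - qI * Γ n) • (V n - (pI / qI) • S (x n)) + Γ n • eV n -
          (pI / qI) • (S (x (n + 1)) - S (x n)) := by
      ext i
      rw [H.V_rec]
      simp
      field_simp
      ring
    have h2 : ‖S (x (n + 1)) - S (x n)‖ ≤ L * (Γ n * (κ * ‖M n‖ + ‖eX n‖)) :=
      (hL _ _).trans (mul_le_mul_of_nonneg_left hx hL0)
    rw [h1]
    calc _ ≤ ‖(1 - qI * Γ n) • (V n - (pI / qI) • S (x n))‖ + ‖Γ n • eV n‖ +
          ‖(pI / qI) • (S (x (n + 1)) - S (x n))‖ :=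
          (norm_sub_le _ _).trans (add_le_add_left (norm_add_le _ _) _)
      _ = (1 - qI * Γ n) * ‖V n - (pI / qI) • S (x n)‖ + Γ n * ‖eV n‖ +
          pI / qI * ‖S (x (n + 1)) - S (x n)‖ := by
          rw [norm_smul, norm_smul, norm_smul, Real.norm_of_nonneg hqΓ,
            Real.norm_of_nonneg hΓ.le, Real.norm_of_nonneg (div_nonneg hp hq.le)]
      _ ≤ (1 - qI * Γ n) * ‖V n - (pI / qI) • S (x n)‖ + Γ n * ‖eV n‖ +
          pI / qI * (L * (Γ n * (κ * ‖M n‖ + ‖eX n‖))) := by gcongr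
      _ = _ := by ring

end PerturbedSystem

end SystemLimit

/-! ### Subsequential limits. -/

section Limits

lemma exists_norm_le_of_tendsto {E : Type*} [NormedAddCommGroup E] {u : ℕ → E} {l : E}
    (hu : Tendsto u atTop (𝓝 l)) : ∃ C : ℝ, 0 ≤ C ∧ ∀ n, ‖u n‖ ≤ C := by
  obtain ⟨C, hC⟩ := (Metric.isBounded_range_of_tendsto u hu).exists_norm_le
  have h : ∀ n, ‖u n‖ ≤ C := fun n => hC _ (mem_range_self n)
  exact ⟨C, (norm_nonneg _).trans (h 0), h⟩

lemma tendsto_smul_zero_of_norm_le {E : Type*} [NormedAddCommGroup E] [NormedSpace ℝ E]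
    {t : ℕ → ℝ} {w : ℕ → E} (ht : Tendsto t atTop (𝓝 0)) {C : ℝ} (hw : ∀ n, ‖w n‖ ≤ C) :
    Tendsto (fun n => t n • w n) atTop (𝓝 0) := by
  refine squeeze_zero_norm (a := fun n => |t n| * C) (fun n => ?_) ?_
  · rw [norm_smul, Real.norm_eq_abs]
    exact mul_le_mul_of_nonneg_left (hw n) (abs_nonneg _)
  · simpa using ht.abs.mul_const C

variable {d : ℕ}

lemma abs_apply_le_norm (w : Vec d) (i : Fin d) : |w i| ≤ ‖w‖ := PiLp.norm_apply_le w i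

/-- A sequence with vanishing increments in a compact set, all of whose subsequential limits lie in
a countable set, converges. -/
lemma exists_tendsto_of_countable {E : Type*} [MetricSpace E] {K C : Set E} (hK : IsCompact K)
    {x : ℕ → E} (hx : ∀ n, x n ∈ K)
    (hinc : Tendsto (fun n => dist (x (n + 1)) (x n)) atTop (𝓝 0)) (hC : C.Countable)
    (hlim : ∀ φ : ℕ → ℕ, StrictMono φ → ∀ a, Tendsto (x ∘ φ) atTop (𝓝 a) → a ∈ C) :
    ∃ a ∈ C, Tendsto x atTop (𝓝 a) := by
  obtain ⟨a, -, φ, hφ, ha⟩ := hK.tendsto_subseq hx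
  refine ⟨a, hlim φ hφ a ha, ?_⟩
  by_contra hcon
  rw [Metric.tendsto_nhds] at hcon
  push Not at hcon
  obtain ⟨D, hD, hfreq⟩ := hcon
  have hnear : ∀ t > 0, ∃ᶠ n in atTop, dist (x n) a < t := fun t ht => by
    have h1 : ∀ᶠ k in atTop, dist (x (φ k)) a < t := (Metric.tendsto_nhds.1 ha) t ht
    exact hφ.tendsto_atTop.frequently h1.frequently
  -- The distance to `a` is infinitely often below t and infinitely often at least D; its steps
  -- vanish, so it clusters at every t in (0, D). By compactness each t is then the distance from
  -- `a` to some point of `C`, and a countable `C` cannot supply them all.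
  have hsub : Ioo 0 D ⊆ (fun b => dist b a) '' C := by
    rintro t ⟨ht0, htD⟩
    have hclus : MapClusterPt t atTop fun n => dist (x n) a := by
      rw [mapClusterPt_iff_frequently]
      intro s hs
      obtain ⟨η, hη, hball⟩ := Metric.mem_nhds_iff.1 hs
      obtain ⟨N₁, hN₁⟩ := eventually_atTop.1 (hinc.eventually_lt_const hη)
      rw [frequently_atTop]
      intro N
      obtain ⟨n₀, hn₀, h0⟩ := frequently_atTop.1 (hnear t ht0) (max N N₁)
      obtain ⟨n₁, hn₁, h1⟩ := frequently_atTop.1 hfreq n₀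
      by_contra hno
      push Not at hno
      have hall : ∀ k ≥ n₀, dist (x k) a < t := by
        intro k hk
        induction k, hk using Nat.le_induction with
        | base => exact h0
        | succ k hk ih =>
          by_contra hge
          rw [not_lt] at hge
          have h2 := hN₁ k (by omega)
          have h3 := dist_triangle (x (k + 1)) (x k) a
          refine hno (k + 1) (by omega) (hball ?_)
          rw [Metric.mem_ball, Real.dist_eq, abs_lt]
          constructor <;> linarith
      linarith [hall n₁ hn₁]
    obtain ⟨ψ, hψ, hψt⟩ := hclus.tendsto_subseq
    obtain ⟨b, -, χ, hχ, hb⟩ := hK.tendsto_subseq (x := x ∘ ψ) fun n => hx _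
    refine ⟨b, hlim (ψ ∘ χ) (hψ.comp hχ) b hb, ?_⟩
    exact tendsto_nhds_unique (hb.dist tendsto_const_nhds) (hψt.comp hχ.tendsto_atTop)
  have h0 := ((hC.image fun b => dist b a).mono hsub).measure_zero volume
  rw [Real.volume_Ioo, sub_zero, ENNReal.ofReal_eq_zero] at h0
  linarith

variable {g S : Vec d → Vec d} {v m x : ℕ → Vec d} {c : ℝ}

/-- Any subsequential limit of `x` gives a limit point of `(v, m, x)` of the right form. -/
lemma tendsto_state_of_subseq (hg : Continuous g) (hS : Continuous S)
    (hm : Tendsto m atTop (𝓝 0)) (hgx : Tendsto (fun n => g (x n)) atTop (𝓝 0))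
    (hv : Tendsto (fun n => v n - c • S (x n)) atTop (𝓝 0)) {φ : ℕ → ℕ}
    (hφ : Tendsto φ atTop atTop) {a : Vec d} (ha : Tendsto (x ∘ φ) atTop (𝓝 a)) :
    g a = 0 ∧ Tendsto (fun n => (v (φ n), m (φ n), x (φ n))) atTop (𝓝 (c • S a, 0, a)) := by
  constructor
  · exact tendsto_nhds_unique ((hg.tendsto a).comp ha) (hgx.comp hφ)
  · have h1 : Tendsto (fun n => S (x (φ n))) atTop (𝓝 (S a)) := (hS.tendsto a).comp ha
    have h2 := (hv.comp hφ).add (h1.const_smul c)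
    simp only [zero_add] at h2
    exact (h2.congr fun n => by simp).prodMk_nhds ((hm.comp hφ).prodMk_nhds ha)

end Limits

/-! ### Removing the noise from the iterates. -/

section NoisyIterates

variable {d : ℕ} {F : Vec d → ℝ} {g S : Vec d → Vec d} {ε hI rI pI qI R : ℝ}
  {Γ h r p q : ℕ → ℝ} {v m x Y : ℕ → Vec d}

/-- The iterates, corrected by the discounted noise, follow the perturbed Euler scheme. -/
lemma exists_perturbedSystem (hF : ∀ u, HasGradientAt F (g u) u) (hg : LocallyLipschitz g)
    (hS : LocallyLipschitz S) (hS0 : ∀ u i, 0 ≤ S u i) (hε : 0 < ε) (hhI : 0 < hI)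
    (hpI : 0 ≤ pI) (hqI : 0 < qI) (hrI : qI / 4 < rI) (hΓ : ∀ n, 0 < Γ n)
    (hΓ0 : Tendsto Γ atTop (𝓝 0))
    (hdiv : Tendsto (fun n => ∑ i ∈ Finset.range n, Γ i) atTop atTop)
    (hh : Tendsto h atTop (𝓝 hI)) (hr : Tendsto r atTop (𝓝 rI)) (hp : Tendsto p atTop (𝓝 pI))
    (hq : Tendsto q atTop (𝓝 qI)) (hv0 : ∀ n i, 0 ≤ v n i)
    (hvrec : ∀ n, v (n + 1) = (1 - Γ n * q n) • v n + (Γ n * p n) • sq (Y n))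
    (hmrec : ∀ n, m (n + 1) = (1 - Γ n * r n) • m n + (Γ n * h n) • Y n)
    (hxrec : ∀ n, x (n + 1) = x n - Γ n • quot ε (m (n + 1)) (v (n + 1)))
    (hvR : ∀ n, ‖v n‖ ≤ R) (hmR : ∀ n, ‖m n‖ ≤ R) (hxR : ∀ n, ‖x n‖ ≤ R)
    (ha : Tendsto (discountedSum Γ fun k => (Γ k * h k) • (Y k - g (x k))) atTop (𝓝 0))
    (hb : Tendsto (discountedSum Γ fun k => (Γ k * p k) • (sq (Y k) - S (x k))) atTop (𝓝 0)) :
    ∃ (R' : ℝ) (a b eV eM eX : ℕ → Vec d), Tendsto a atTop (𝓝 0) ∧ Tendsto b atTop (𝓝 0) ∧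
      PerturbedSystem F g S ε hI rI pI qI R' Γ (fun n => v n - b n) (fun n => m n - a n) x
        eV eM eX := by
  set a : ℕ → Vec d := discountedSum Γ fun k => (Γ k * h k) • (Y k - g (x k))
  set b : ℕ → Vec d := discountedSum Γ fun k => (Γ k * p k) • (sq (Y k) - S (x k))
  have harec : ∀ n, a (n + 1) = (1 - Γ n) • a n + (Γ n * h n) • (Y n - g (x n)) := fun n => rfl
  have hbrec : ∀ n, b (n + 1) = (1 - Γ n) • b n + (Γ n * p n) • (sq (Y n) - S (x n)) :=
    fun n => rfl
  obtain ⟨A, hA0, hA⟩ := exists_norm_le_of_tendsto ha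
  obtain ⟨B, hB0, hB⟩ := exists_norm_le_of_tendsto hb
  have hball : ∀ n, x n ∈ Metric.closedBall (0 : Vec d) R := fun n => by simpa using hxR n
  obtain ⟨Cg, hCg⟩ := (isCompact_closedBall (0 : Vec d) R).exists_bound_of_continuousOn
    hg.continuous.continuousOn
  obtain ⟨CS, hCS⟩ := (isCompact_closedBall (0 : Vec d) R).exists_bound_of_continuousOn
    hS.continuous.continuousOn
  have hCg' : ∀ n, ‖g (x n)‖ ≤ Cg := fun n => hCg _ (hball n)
  have hCS' : ∀ n, ‖S (x n)‖ ≤ CS := fun n => hCS _ (hball n)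
  have hR : 0 ≤ R := (norm_nonneg _).trans (hxR 0)
  set V : ℕ → Vec d := fun n => v n - b n with hV
  set M : ℕ → Vec d := fun n => m n - a n with hM
  -- The correction b is discounted at rate 1 while v relaxes at rate q_∞; the mismatch leaves (1 -
  -- q_∞) b, which vanishes. The same holds for `eM` with r_∞.
  set eV : ℕ → Vec d := fun n =>
    (p n - pI) • S (x n) - (q n - qI) • v n + (1 - qI) • b n with heV
  set eM : ℕ → Vec d := fun n =>
    (h n - hI) • g (x n) - (r n - rI) • m n + (1 - rI) • a n with heM
  -- This absorbs both the noise correction and the use of the updated m_{n+1}, v_{n+1} in the step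
  -- of x; it vanishes by uniform continuity of the quotient where v ≥ -ε/2.
  set eX : ℕ → Vec d := fun n =>
    quot ε (M n) (V n) - quot ε (m (n + 1)) (v (n + 1)) with heX
  have hdiff : ∀ {u : ℕ → ℝ} {l : ℝ}, Tendsto u atTop (𝓝 l) →
      Tendsto (fun n => u n - l) atTop (𝓝 0) := fun hu => tendsto_sub_nhds_zero_iff.2 hu
  have heV0 : Tendsto eV atTop (𝓝 0) := by
    simpa using ((tendsto_smul_zero_of_norm_le (hdiff hp) hCS').sub
      (tendsto_smul_zero_of_norm_le (hdiff hq) hvR)).add (hb.const_smul (1 - qI))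
  have heM0 : Tendsto eM atTop (𝓝 0) := by
    simpa using ((tendsto_smul_zero_of_norm_le (hdiff hh) hCg').sub
      (tendsto_smul_zero_of_norm_le (hdiff hr) hmR)).add (ha.const_smul (1 - rI))
  have hVrec : ∀ n, V (n + 1) = V n + Γ n • ((pI • S (x n) - qI • V n) + eV n) := by
    intro n
    simp only [hV, heV, hvrec, hbrec]
    ext i
    simp
    ring
  have hMrec : ∀ n, M (n + 1) = M n + Γ n • ((hI • g (x n) - rI • M n) + eM n) := by
    intro n
    simp only [hM, heM, hmrec, harec]
    ext i
    simp
    ring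
  have hVR : ∀ n, ‖V n‖ ≤ R + A + B := fun n =>
    (norm_sub_le _ _).trans (by linarith [hvR n, hB n])
  have hMR : ∀ n, ‖M n‖ ≤ R + A + B := fun n =>
    (norm_sub_le _ _).trans (by linarith [hmR n, hA n])
  have hVge : ∀ᶠ n in atTop, ∀ i, -(ε / 2) ≤ V n i := by
    filter_upwards [(tendsto_zero_iff_norm_tendsto_zero.1 hb).eventually_le_const
      (show 0 < ε / 2 by positivity)] with n hn i
    have h1 := (abs_apply_le_norm (b n) i).trans hn
    have h2 := hv0 n i
    have h3 : V n i = v n i - b n i := rfl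
    rw [h3]
    linarith [le_abs_self (b n i)]
  have hstepV : Tendsto (fun n => v (n + 1) - V n) atTop (𝓝 0) := by
    obtain ⟨C, -, hC⟩ := exists_norm_le_of_tendsto heV0
    have h1 : ∀ n, ‖(pI • S (x n) - qI • V n) + eV n‖ ≤
        |pI| * CS + |qI| * (R + A + B) + C := by
      intro n
      refine (norm_add_le _ _).trans (add_le_add ((norm_sub_le _ _).trans ?_) (hC n))
      rw [norm_smul, norm_smul]
      exact add_le_add (mul_le_mul_of_nonneg_left (hCS' n) (abs_nonneg _))
        (mul_le_mul_of_nonneg_left (hVR n) (abs_nonneg _))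
    have h2 := (tendsto_smul_zero_of_norm_le hΓ0 h1).add (hb.comp (tendsto_add_atTop_nat 1))
    rw [add_zero] at h2
    refine h2.congr fun n => ?_
    have h3 : v (n + 1) = V (n + 1) + b (n + 1) := by simp [hV]
    rw [h3, hVrec]
    simp only [Function.comp]
    abel
  have hstepM : Tendsto (fun n => m (n + 1) - M n) atTop (𝓝 0) := by
    obtain ⟨C, -, hC⟩ := exists_norm_le_of_tendsto heM0
    have h1 : ∀ n, ‖(hI • g (x n) - rI • M n) + eM n‖ ≤
        |hI| * Cg + |rI| * (R + A + B) + C := by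
      intro n
      refine (norm_add_le _ _).trans (add_le_add ((norm_sub_le _ _).trans ?_) (hC n))
      rw [norm_smul, norm_smul]
      exact add_le_add (mul_le_mul_of_nonneg_left (hCg' n) (abs_nonneg _))
        (mul_le_mul_of_nonneg_left (hMR n) (abs_nonneg _))
    have h2 := (tendsto_smul_zero_of_norm_le hΓ0 h1).add (ha.comp (tendsto_add_atTop_nat 1))
    rw [add_zero] at h2
    refine h2.congr fun n => ?_
    have h3 : m (n + 1) = M (n + 1) + a (n + 1) := by simp [hM]
    rw [h3, hMrec]
    simp only [Function.comp]
    abel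
  have heX0 : Tendsto eX atTop (𝓝 0) := by
    set K : Set (Vec d × Vec d) :=
      Metric.closedBall 0 (R + A + B) ∩ {y | ∀ i, -(ε / 2) ≤ y.2 i} with hKdef
    have hK : IsCompact K := by
      refine (isCompact_closedBall _ _).inter_right ?_
      simp only [ofPred_forall]
      exact isClosed_iInter fun i => isClosed_le continuous_const (by fun_prop)
    have hcont : ContinuousOn (fun y : Vec d × Vec d => quot ε y.1 y.2) K := by
      refine (PiLp.continuous_toLp 2 _).comp_continuousOn (continuousOn_pi.2 fun i => ?_)
      refine ContinuousOn.div (by fun_prop) (by fun_prop) fun y hy => ?_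
      have := hy.2 i
      exact (Real.sqrt_pos.2 (by linarith)).ne'
    have h1 := dist_image_tendsto_zero hK hcont (u := fun n => (M n, V n))
      (w := fun n => (m (n + 1), v (n + 1))) ?_ ?_ ?_
    · rw [tendsto_zero_iff_norm_tendsto_zero]
      simpa [dist_eq_norm] using h1
    · filter_upwards [hVge] with n hn
      refine ⟨?_, hn⟩
      simp only [Metric.mem_closedBall, dist_zero_right, Prod.norm_def]
      exact max_le (hMR n) (hVR n)
    · refine Eventually.of_forall fun n => ⟨?_, fun i => ?_⟩
      · simp only [Metric.mem_closedBall, dist_zero_right, Prod.norm_def]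
        exact max_le (by linarith [hmR (n + 1)]) (by linarith [hvR (n + 1)])
      · have := hv0 (n + 1) i
        simp only
        linarith
    · have h2 := (tendsto_zero_iff_norm_tendsto_zero.1 hstepM).max
        (tendsto_zero_iff_norm_tendsto_zero.1 hstepV)
      rw [max_self] at h2
      refine h2.congr fun n => ?_
      rw [dist_comm, Prod.dist_eq, dist_eq_norm, dist_eq_norm]
  refine ⟨R + A + B, a, b, eV, eM, eX, ha, hb, ?_⟩
  exact
    { hasGradientAt := hF
      g_lip := hg
      S_lip := hS
      S_nonneg := hS0
      ε_pos := hε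
      hI_pos := hhI
      pI_nonneg := hpI
      qI_pos := hqI
      rI_gt := hrI
      Γ_pos := hΓ
      Γ_zero := hΓ0
      Γ_div := hdiv
      V_rec := hVrec
      M_rec := hMrec
      x_rec := fun n => by
        rw [hxrec, sub_eq_add_neg, ← smul_neg]
        congr 2
        change _ = -quot ε (M n) (V n) + (quot ε (M n) (V n) - quot ε (m (n + 1)) (v (n + 1)))
        abel
      eV_zero := heV0
      eM_zero := heM0
      eX_zero := heX0
      V_le := hVR
      M_le := hMR
      x_le := fun n => by linarith [hxR n]
      V_ge := hVge }

lemma PerturbedSystem.tendsto_of_noise {R' : ℝ} {a b eV eM eX : ℕ → Vec d}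
    (H : PerturbedSystem F g S ε hI rI pI qI R' Γ (fun n => v n - b n) (fun n => m n - a n) x
        eV eM eX) (ha : Tendsto a atTop (𝓝 0)) (hb : Tendsto b atTop (𝓝 0))
    (hsard : interior (F '' {u | g u = 0}) = ∅) :
    Tendsto m atTop (𝓝 0) ∧ Tendsto (fun n => g (x n)) atTop (𝓝 0) ∧
      Tendsto (fun n => v n - (pI / qI) • S (x n)) atTop (𝓝 0) ∧
      Tendsto (fun n => dist (x (n + 1)) (x n)) atTop (𝓝 0) := by
  obtain ⟨hM, hgx⟩ := H.tendsto_dissipation hsard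
  have hV := H.tendsto_V_sub hM
  refine ⟨?_, hgx, ?_, ?_⟩
  · simpa using hM.add ha
  · have := hV.add hb
    rw [add_zero] at this
    exact this.congr fun n => by abel
  · obtain ⟨B, -, hB⟩ := H.exists_increment_bound
    simp only [dist_eq_norm]
    refine squeeze_zero' (Eventually.of_forall fun n => norm_nonneg _)
      (hB.mono fun n h => h.2.2) ?_
    simpa using H.Γ_zero.const_mul B

end NoisyIterates

/-! ### Coefficient sequences and signs. -/

section Coefficients

variable {γ : ℕ → ℝ}

lemma tau_eq_sum_range (γ : ℕ → ℝ) (n : ℕ) : tau γ n = ∑ i ∈ Finset.range n, γ (i + 1) := by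
  induction n with
  | zero => simp [tau]
  | succ n ih =>
    rw [Finset.sum_range_succ, ← ih, tau, tau, Finset.sum_Icc_succ_top (by omega)]

lemma Stepsizes.tau_pos (hγ : Stepsizes γ) {n : ℕ} (hn : n ≠ 0) : 0 < tau γ n :=
  Finset.sum_pos (fun k hk => hγ.pos k (Finset.mem_Icc.1 hk).1)
    ⟨1, Finset.mem_Icc.2 ⟨le_rfl, Nat.one_le_iff_ne_zero.2 hn⟩⟩

lemma Stepsizes.tendsto_coeffSeq (hγ : Stepsizes γ) (a0 : ℝ) {a : ℝ → ℝ} {l : ℝ}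
    (ha : Tendsto a atTop (𝓝 l)) : Tendsto (coeffSeq γ a0 a) atTop (𝓝 l) := by
  refine (ha.comp hγ.diverges).congr' ?_
  filter_upwards [eventually_ne_atTop 0] with n hn
  simp [coeffSeq, hn]

lemma Stepsizes.coeffSeq_nonneg (hγ : Stepsizes γ) {a0 : ℝ} (ha0 : 0 ≤ a0) {a : ℝ → ℝ}
    (ha : ∀ t, 0 < t → 0 ≤ a t) (n : ℕ) : 0 ≤ coeffSeq γ a0 a n := by
  unfold coeffSeq
  split_ifs with h
  · exact ha0
  · exact ha _ (hγ.tau_pos h)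

lemma secondMoment_nonneg {d : ℕ} {Ξ : Type*} [MeasurableSpace Ξ] {μ : Measure Ξ}
    {f : Vec d → Ξ → ℝ} (hf : RegularModel μ f) (x : Vec d) (i : Fin d) :
    0 ≤ secondMoment μ f x i := by
  rw [secondMoment, integral_apply (hf.integrable_sq x)]
  exact integral_nonneg fun s => sq_nonneg _

lemma iterate_fst_nonneg {d : ℕ} {Ξ : Type*} {f : Vec d → Ξ → ℝ} {ε : ℝ} {γ h r p q : ℕ → ℝ}
    {ξ : ℕ → Ξ} {z0 : State d} (hz0 : ∀ i, 0 ≤ z0.1 i) (hγ : ∀ n, 0 ≤ γ (n + 1))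
    (hp : ∀ n, 0 ≤ p n) (hq : ∀ n, 0 ≤ 1 - γ (n + 1) * q n) (n : ℕ) (i : Fin d) :
    0 ≤ (iterate f ε γ h r p q ξ z0 n).1 i := by
  induction n with
  | zero => exact hz0 i
  | succ n ih =>
    have h1 := mul_nonneg (hq n) ih
    have h2 := mul_nonneg (mul_nonneg (hγ n) (hp n))
      (sq_nonneg (grad f (iterate f ε γ h r p q ξ z0 n).2.2 (ξ (n + 1)) i))
    simpa [iterate, step, sq_apply] using add_nonneg h1 h2

end Coefficients

end StochAlg

end

/-! ### Proof of the theorem. -/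

theorem mainTheorem1 {d : ℕ}
    -- the model
    {Ξ : Type*} [MeasurableSpace Ξ] (μ : Measure Ξ) [IsProbabilityMeasure μ]
    (f : StochAlg.Vec d → Ξ → ℝ) (hf : StochAlg.RegularModel μ f)
    (hcoercive : Tendsto (StochAlg.objective μ f) (cocompact (StochAlg.Vec d)) atTop)
    -- the coefficient functions and the stepsizes
    (h r p q : ℝ → ℝ) (hInf rInf pInf qInf : ℝ)
    (hcoeff : StochAlg.Coefficients h r p q hInf rInf pInf qInf)
    (γ : ℕ → ℝ) (hγ : StochAlg.Stepsizes γ)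
    (h0 r0 p0 q0 : ℝ) (hh0 : 0 < h0) (hr0 : 0 < r0) (hp0 : 0 < p0) (hq0 : 0 < q0)
    (hstep : ∀ n, 0 ≤ 1 - γ (n + 1) * StochAlg.coeffSeq γ q0 q n)
    -- the noise condition and the Sard-type condition
    (hnoise : StochAlg.MomentCondition μ f γ ∨ StochAlg.SubGaussianCondition μ f γ)
    (hsard : interior
      (StochAlg.objective μ f '' StochAlg.criticalSet (StochAlg.objective μ f)) = ∅)
    -- the i.i.d. samples `ξ_1, ξ_2, …` of law `μ` (the value `ξ 0` is never used)
    {Ω : Type*} [MeasurableSpace Ω] (P : Measure Ω) [IsProbabilityMeasure P]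
    (ξ : ℕ → Ω → Ξ) (hξ_meas : ∀ n, 1 ≤ n → Measurable (ξ n))
    (hξ_law : ∀ n, 1 ≤ n → P.map (ξ n) = μ)
    (hξ_indep : iIndepFun (fun n => ξ (n + 1)) P)
    -- the iterates, assumed to be almost surely bounded
    (ε : ℝ) (hε : 0 < ε) (z0 : StochAlg.State d) (hz0 : ∀ i, 0 ≤ z0.1 i)
    (z : ℕ → Ω → StochAlg.State d)
    (hz : ∀ n ω, z n ω = StochAlg.iterate f ε γ (StochAlg.coeffSeq γ h0 h)
      (StochAlg.coeffSeq γ r0 r) (StochAlg.coeffSeq γ p0 p) (StochAlg.coeffSeq γ q0 q)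
      (fun k => ξ k ω) z0 n)
    (hbounded : ∀ᵐ ω ∂P, Bornology.IsBounded (range fun n => z n ω)) :
    (∀ᵐ ω ∂P, Tendsto
      (fun n => Metric.infEDist (z n ω) (StochAlg.limitSet (StochAlg.objective μ f)
        (StochAlg.secondMoment μ f) pInf qInf)) atTop (𝓝 0)) ∧
    ((StochAlg.criticalSet (StochAlg.objective μ f)).Countable →
      ∀ᵐ ω ∂P, ∃ zStar ∈ StochAlg.limitSet (StochAlg.objective μ f)
        (StochAlg.secondMoment μ f) pInf qInf,
        Tendsto (fun n => z n ω) atTop (𝓝 zStar)) := by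
  open StochAlg in
  set Γ : ℕ → ℝ := fun n => γ (n + 1) with hΓdef
  set F := objective μ f with hFdef
  set g : Vec d → Vec d := gradient F with hgdef
  set S := secondMoment μ f with hSdef
  set hs := coeffSeq γ h0 h with hhs
  set rs := coeffSeq γ r0 r with hrs
  set ps := coeffSeq γ p0 p with hps
  set qs := coeffSeq γ q0 q with hqs
  have hΓ : ∀ n, 0 < Γ n := fun n => hγ.pos _ (Nat.le_add_left 1 n)
  have hdiv : Tendsto (fun n => ∑ i ∈ Finset.range n, Γ i) atTop atTop :=
    hγ.diverges.congr fun n => tau_eq_sum_range γ n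
  have hng := noiseCondition_grad hf hnoise
  have hns := noiseCondition_sq_grad (μ := μ) hnoise
  have hΓ0 : Tendsto Γ atTop (𝓝 0) := hng.tendsto_zero hΓ
  have hhlim : Tendsto hs atTop (𝓝 hInf) := hγ.tendsto_coeffSeq h0 hcoeff.h_lim
  have hrlim : Tendsto rs atTop (𝓝 rInf) := hγ.tendsto_coeffSeq r0 hcoeff.r_lim
  have hplim : Tendsto ps atTop (𝓝 pInf) := hγ.tendsto_coeffSeq p0 hcoeff.p_lim
  have hqlim : Tendsto qs atTop (𝓝 qInf) := hγ.tendsto_coeffSeq q0 hcoeff.q_lim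
  have hps0 : ∀ n, 0 ≤ ps n := hγ.coeffSeq_nonneg hp0.le fun t ht => (hcoeff.nonneg t ht).2.2.1
  have hpI : 0 ≤ pInf := ge_of_tendsto' hplim hps0
  have hg_lip : LocallyLipschitz g := hf.locallyLipschitz_gradient
  have hS_lip : LocallyLipschitz S := hf.locallyLipschitz_secondMoment
  have hF : ∀ u, HasGradientAt F (g u) u := fun u =>
    (hf.hasGradientAt_objective u).differentiableAt.hasGradientAt
  obtain ⟨A₁, -, hA₁⟩ := exists_norm_le_of_tendsto hhlim
  obtain ⟨A₂, -, hA₂⟩ := exists_norm_le_of_tendsto hplim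
  -- Samples renumbered from 0, so that ζ_n drives the passage from z_n to z_{n+1}, in step with
  -- Γ_n.
  set ζ : ℕ → Ω → Ξ := fun n => ξ (n + 1) with hζdef
  have hζ : ∀ n, Measurable (ζ n) := fun n => hξ_meas _ (Nat.le_add_left 1 n)
  have hlaw : ∀ n, P.map (ζ n) = μ := fun n => hξ_law _ (Nat.le_add_left 1 n)
  have hX : ∀ k, Measurable[past ζ k] fun ω => (z k ω).2.2 := fun k => by
    simp only [hz]
    exact (hf.measurable_iterate ε γ hs rs ps qs ξ z0 k).snd.snd
  have hmean : ∀ u, ∫ s, grad f u s ∂μ = g u := fun u => (hf.gradient_objective u).symm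
  have hnoise₁ := ae_tendsto_discountedSum_noise hζ hlaw hξ_indep hX hΓ hdiv hf.measurable_grad
    hf.integrable_grad (by simpa only [hmean] using hg_lip.continuous) hng hA₁
  have hnoise₂ := ae_tendsto_discountedSum_noise hζ hlaw hξ_indep hX hΓ hdiv
    (G := fun u s => StochAlg.sq (grad f u s)) (measurable_sq.comp hf.measurable_grad)
    hf.integrable_sq hS_lip.continuous hns hA₂
  have key : ∀ᵐ ω ∂P, (∃ R : ℝ, ∀ n, ‖(z n ω).2.2‖ ≤ R) ∧
      Tendsto (fun n => (z n ω).2.1) atTop (𝓝 0) ∧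
      Tendsto (fun n => g (z n ω).2.2) atTop (𝓝 0) ∧
      Tendsto (fun n => (z n ω).1 - (pInf / qInf) • S (z n ω).2.2) atTop (𝓝 0) ∧
      Tendsto (fun n => dist (z (n + 1) ω).2.2 (z n ω).2.2) atTop (𝓝 0) := by
    filter_upwards [hbounded, hnoise₁, hnoise₂] with ω hb h1 h2
    obtain ⟨R, hR⟩ := hb.exists_norm_le
    have hzR : ∀ n, ‖z n ω‖ ≤ R := fun n => hR _ (mem_range_self n)
    have hxR : ∀ n, ‖(z n ω).2.2‖ ≤ R := fun n =>
      ((norm_snd_le _).trans (norm_snd_le _)).trans (hzR n)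
    have hzrec : ∀ n, z (n + 1) ω = step f ε (γ (n + 1)) (hs n) (rs n) (ps n) (qs n) (ξ (n + 1) ω)
        (z n ω) := fun n => by rw [hz, hz, iterate]
    obtain ⟨R', a, b, eV, eM, eX, ha, hb, H⟩ := exists_perturbedSystem
      (v := fun n => (z n ω).1) (m := fun n => (z n ω).2.1) (x := fun n => (z n ω).2.2)
      (Y := fun n => grad f (z n ω).2.2 (ζ n ω)) hF hg_lip hS_lip (secondMoment_nonneg hf) hε
      hcoeff.hInf_pos hpI hcoeff.qInf_pos hcoeff.rInf_gt hΓ hΓ0 hdiv hhlim hrlim hplim hqlim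
      (fun n i => by
        rw [hz]
        exact iterate_fst_nonneg hz0 (fun n => (hΓ n).le) hps0 hstep n i)
      (fun n => by rw [hzrec]; rfl) (fun n => by rw [hzrec]; rfl) (fun n => by rw [hzrec]; rfl)
      (fun n => (norm_fst_le _).trans (hzR n))
      (fun n => ((norm_fst_le _).trans (norm_snd_le _)).trans (hzR n)) hxR
      (by simpa only [hmean] using h1 ⟨R, hxR⟩) (h2 ⟨R, hxR⟩)
    exact ⟨⟨R, hxR⟩, H.tendsto_of_noise ha hb hsard⟩
  constructor
  · filter_upwards [key] with ω hω
    obtain ⟨⟨R, hR⟩, hm, hgx, hv, -⟩ := hω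
    -- It suffices that each subsequence has a further one along which x converges; z then converges
    -- to a point of the limit set.
    refine tendsto_of_subseq_tendsto fun ns hns => ?_
    obtain ⟨a, -, φ, hφ, ha⟩ := (isCompact_closedBall (0 : Vec d) R).tendsto_subseq
      (x := fun n => (z (ns n) ω).2.2) fun n => by simpa using hR (ns n)
    obtain ⟨hga, hza⟩ := tendsto_state_of_subseq hg_lip.continuous hS_lip.continuous hm hgx hv
      (hns.comp hφ.tendsto_atTop) ha
    refine ⟨φ, tendsto_of_tendsto_of_tendsto_of_le_of_le tendsto_const_nhds
      (tendsto_iff_edist_tendsto_0.1 hza) (fun n => zero_le) fun n => ?_⟩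
    exact Metric.infEDist_le_edist_of_mem ⟨a, hga, rfl⟩
  · intro hcount
    filter_upwards [key] with ω hω
    obtain ⟨⟨R, hR⟩, hm, hgx, hv, hinc⟩ := hω
    have hball : ∀ n, (z n ω).2.2 ∈ Metric.closedBall (0 : Vec d) R := fun n => by
      simpa using hR n
    obtain ⟨a, -, ha⟩ := exists_tendsto_of_countable (x := fun n => (z n ω).2.2)
      (isCompact_closedBall (0 : Vec d) R) hball hinc hcount fun φ hφ a ha =>
        (tendsto_state_of_subseq hg_lip.continuous hS_lip.continuous hm hgx hv
          hφ.tendsto_atTop ha).1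
    obtain ⟨hga, hza⟩ := tendsto_state_of_subseq hg_lip.continuous hS_lip.continuous hm hgx hv
      (φ := id) tendsto_id ha
    exact ⟨_, ⟨a, hga, rfl⟩, hza⟩
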